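/- For $n\ge 1$ let $Q_n$ be the hypercube graph on the vertex set $\{0,1\}^n$, two vertices being adjacent if they differ in exactly one position, called the star position of that edge. Let $C_m$ denote the cycle of length $m$. For graphs $G,T,H$ let $N(G,T)$ be the number of subgraphs of $G$ isomorphic to $T$, let $\mathrm{ex}(G,T,H)$ be the maximum of $N(G',T)$ over all subgraphs $G'\subseteq G$ containing no subgraph isomorphic to $H$, and let $\mathbf d(G,T,H)=\mathrm{ex}(G,T,H)/N(G,T)$. Let $z_{\ell,\ell}$ be the number of subgraphs of $Q_\ell$ that are isomorphic to $C_{2\ell}$ and in which all $\ell$ positions occur as star positions of edges. **Theorem.** For every integer $k\ge 4$, $k\ne 5$, there is a constant $c_k>0$ depending only on $k$ such that the following holds for every integer $\ell\ge 2$ with $\ell\neq k$. We have $z_{\ell,\ell}>0$, and for every $n$ with $2\ell\le 2^n$ we have $N(Q_n,C_{2\ell})>0$ and $$\mathbf d(Q_n,C_{2\ell},C_{2k})\le c_k\,n^{-1/16}.$$ Moreover, for $n\ge \ell$, $$\binom{n}{\ell}^{-1}\,\frac{2^{\ell-\lceil\log_2(2\ell)\rceil}}{z_{\ell,\ell}}\,(1-o(1))\le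 \mathbf d(Q_n,C_{2\ell},C_{2k}),$$ where $o(1)$ is a non-negative function of $n$ that tends to $0$ as $n\to\infty$ with $k$ and $\ell$ fixed. -/

import Mathlib

/-- The hypercube graph `Q_n`: the vertices are the binary sequences of length `n`, and two of them
are adjacent when they differ in exactly one position. -/
def hypercube (n : ℕ) : SimpleGraph (Fin n → Bool) where
  Adj x y := hammingDist x y = 1
  symm := ⟨fun x y h => by rw [hammingDist_comm]; exact h⟩
  loopless := ⟨fun x h => by simp at h⟩

/-- The generalized extremal function `ex(G, T, H)`: the maximum, over the `H`-free subgraphs `G'`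
of `G`, of the number of (unlabelled) copies of `T` in `G'`. Subgraphs are taken spanning; a deleted
vertex is the same as an isolated one, since `T` and `H` are graphs without isolated vertices. -/
noncomputable def genEx {V U W : Type*} [Fintype V]
    (G : SimpleGraph V) (T : SimpleGraph U) (H : SimpleGraph W) : ℕ :=
  sSup {m : ℕ | ∃ G' : SimpleGraph V, G' ≤ G ∧ H.Free G' ∧ m = G'.copyCount T}

/-- The supremum in the definition of `genEx` is over a finite set, hence it is a maximum as soon as
`G` has an `H`-free subgraph. -/
theorem genEx_set_finite {V U W : Type*} [Fintype V]
    (G : SimpleGraph V) (T : SimpleGraph U) (H : SimpleGraph W) :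
    {m : ℕ | ∃ G' : SimpleGraph V, G' ≤ G ∧ H.Free G' ∧ m = G'.copyCount T}.Finite := by
  refine (Set.finite_range (fun G' : SimpleGraph V => G'.copyCount T)).subset ?_
  rintro m ⟨G', -, -, rfl⟩
  exact ⟨G', rfl⟩

/-- The generalized Turán density `d(G, T, H) = ex(G, T, H) / N(G, T)`. -/
noncomputable def genTuranDensity {V U W : Type*} [Fintype V]
    (G : SimpleGraph V) (T : SimpleGraph U) (H : SimpleGraph W) : ℝ :=
  (genEx G T H : ℝ) / (G.copyCount T : ℝ)

/-- `z_{k,ℓ}`: the number of copies of `C_{2ℓ}` in `Q_k` whose edges use all `k` star positions,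
i.e. for every position `i` some edge of the copy joins two vertices that differ in position `i`. -/
noncomputable def starCycleCount (k l : ℕ) : ℕ :=
  {C : (hypercube k).Subgraph | Nonempty (SimpleGraph.cycleGraph (2 * l) ≃g C.coe) ∧
    ∀ i : Fin k, ∃ x y, C.Adj x y ∧ x i ≠ y i}.ncard

/-! Upper bound. `Q_n` is arc-transitive, so a subgraph `G` holds at most the share e(G)/e(Q_n) of
the copies of any graph with an edge (`copyCount_mul_adjPairCount_le`). It remains to bound the edge
density of a `C_{2k}`-free `G`. Seen from a base vertex `S`, vertices of the cube are finite sets of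
positions. A vertex `v` with edges in directions `x, u, w` becomes the set `{x, u, w}`, joined to
its three pairs, for the base obtained by flipping those positions of `v`. Averaging over bases
yields one `S` with at least a³/4 ordered triples of this kind, where a bounds the average degree
from below. Two positions `x, x'` then have a dense common link graph, in which dependent random
choice finds a `2m`-cycle with a pendant edge. The cycle in the link of `x` lifts to `C_{4m}`; a
detour through the link of the other position and the pendant edge gives `C_{4m+6}`. These lengths
cover 2k for every k ≥ 4 except 5 (`cycles_isContained_of_average_degree`).

Lower bound. With q = ⌈log₂ 2ℓ⌉ the cube `Q_q` contains `C_{2ℓ}`. One copy in each of the 2^(n-q)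
parallel subcubes gives disjoint cycles, hence no `C_{2k}`. All but a vanishing share of the
`2ℓ`-cycles of `Q_n` have ℓ star positions, so their total is at most (1+o(1)) binom(n,ℓ) 2^(n-ℓ)
z_{ℓ,ℓ} (`copyCount_cycleGraph_le`). -/

/-! ### Cycle graphs and their containments -/

/-- A cyclic sequence of distinct vertices with consecutive ones adjacent gives a copy of the
cycle graph. -/
theorem exists_copy_cycleGraph {V : Type*} {H : SimpleGraph V} {N : ℕ} (f : ℕ → V)
    (hinj : ∀ i < N, ∀ j < N, f i = f j → i = j)
    (hadj : ∀ i, i + 1 < N → H.Adj (f i) (f (i + 1))) (hlast : H.Adj (f (N - 1)) (f 0)) :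
    ∃ F : SimpleGraph.Copy (SimpleGraph.cycleGraph N) H, ∀ i : Fin N, F i = f i := by
  have key : ∀ u v : Fin N, (u - v).val = 1 → H.Adj (f u) (f v) := by
    intro u v h
    have hu := u.isLt
    have hv := v.isLt
    rcases le_or_gt v u with hle | hlt
    · rw [Fin.sub_val_of_le hle] at h
      have hle' : v.val ≤ u.val := hle
      have e : u.val = v.val + 1 := by omega
      rw [e]
      exact (hadj _ (by omega)).symm
    · rw [Fin.coe_sub_iff_lt.2 hlt] at h
      have hlt' : u.val < v.val := hlt
      have e1 : u.val = 0 := by omega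
      have e2 : v.val = N - 1 := by omega
      rw [e1, e2]
      exact hlast.symm
  refine ⟨⟨⟨fun i => f i, ?_⟩, ?_⟩, fun i => rfl⟩
  · intro u v h
    rw [SimpleGraph.cycleGraph_adj'] at h
    rcases h with h | h
    · exact key u v h
    · exact (key v u h).symm
  · intro u v h
    exact Fin.ext (hinj _ u.isLt _ v.isLt h)

open SimpleGraph in
/-- An injective homomorphism between cycles of length at least three exists only if the lengths
agree. -/
theorem eq_of_cycleGraph_isContained {a b : ℕ} (ha : 3 ≤ a) (hb : 3 ≤ b)
    (h : SimpleGraph.cycleGraph a ⊑ SimpleGraph.cycleGraph b) : a = b := by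
  obtain ⟨f⟩ := h
  obtain ⟨a, rfl⟩ := Nat.exists_eq_add_of_le' ha
  obtain ⟨b, rfl⟩ := Nat.exists_eq_add_of_le' hb
  -- Both cycles are 2-regular, so the images of the two neighbours of `i` exhaust the neighbours of
  -- `f i`. The image is closed under adjacency, hence everything by connectedness.
  have hclosed : ∀ (i : Fin (a + 3)) (w : Fin (b + 3)),
      (SimpleGraph.cycleGraph (b + 3)).Adj (f i) w → ∃ j, f j = w := by
    intro i w hw
    have hsub : ((SimpleGraph.cycleGraph (a + 3)).neighborFinset i).image f ⊆
        (SimpleGraph.cycleGraph (b + 3)).neighborFinset (f i) := by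
      intro x hx
      rw [Finset.mem_image] at hx
      obtain ⟨j, hj, rfl⟩ := hx
      rw [SimpleGraph.mem_neighborFinset] at hj ⊢
      exact f.toHom.map_adj hj
    have heq := Finset.eq_of_subset_of_card_le hsub (by
      rw [Finset.card_image_of_injective _ (show Function.Injective f from f.injective),
        SimpleGraph.card_neighborFinset_eq_degree,
        SimpleGraph.card_neighborFinset_eq_degree, SimpleGraph.cycleGraph_degree_three_le,
        SimpleGraph.cycleGraph_degree_three_le])
    have : w ∈ (SimpleGraph.cycleGraph (b + 3)).neighborFinset (f i) := by
      rwa [SimpleGraph.mem_neighborFinset]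
    rw [← heq, Finset.mem_image] at this
    obtain ⟨j, -, hj⟩ := this
    exact ⟨j, hj⟩
  have hsurj : Function.Surjective f := by
    intro w
    obtain ⟨p⟩ := SimpleGraph.cycleGraph_preconnected (f 0) w
    have : ∀ (x y : Fin (b + 3)) (_ : (SimpleGraph.cycleGraph (b + 3)).Walk x y),
        (∃ j, f j = x) → ∃ j, f j = y := by
      intro x y p
      induction p with
      | nil => exact id
      | cons hxy _ ih =>
        rintro ⟨j, rfl⟩
        exact ih (hclosed j _ hxy)
    exact this _ _ p ⟨0, rfl⟩
  simpa using Fintype.card_of_bijective (f := f) ⟨f.injective, hsurj⟩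

/-! ### Counting copies, and the proportional share in arc-transitive graphs -/

open Classical in
theorem labelledCopyCount_eq_natCard {V W : Type*} [Fintype V] [Fintype W]
    (G : SimpleGraph V) (T : SimpleGraph W) :
    G.labelledCopyCount T = Nat.card (SimpleGraph.Copy T G) := by
  rw [SimpleGraph.labelledCopyCount]
  exact Nat.card_eq_fintype_card.symm

open Classical in
/-- The labelled copies of `T` in `G` are the unlabelled ones counted with the automorphisms
of `T`. -/
theorem labelledCopyCount_eq_copyCount_mul {V W : Type*} [Fintype V] [Fintype W]
    (G : SimpleGraph V) (T : SimpleGraph W) :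
    G.labelledCopyCount T = G.copyCount T * Nat.card (T ≃g T) := by
  -- After fixing one isomorphism `e` onto `C`, the copies with image `C` are exactly `e` composed
  -- with the automorphisms of `T`.
  have hfib : ∀ C ∈ (Finset.univ.filter fun C : G.Subgraph => Nonempty (T ≃g C.coe)),
      (Finset.univ.filter fun f : SimpleGraph.Copy T G => f.toSubgraph = C).card =
        Nat.card (T ≃g T) := by
    intro C hC
    rw [Finset.mem_filter] at hC
    obtain ⟨-, ⟨e⟩⟩ := hC
    let g : SimpleGraph.Copy T G := C.coeCopy.comp e.toCopy
    have hg : ∀ a, g a = (e a : V) := fun a => rfl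
    have : Finite (T ≃g T) := Finite.of_injective (fun e => (e : W → W)) DFunLike.coe_injective
    have := Fintype.ofFinite (T ≃g T)
    rw [Nat.card_eq_fintype_card, ← Fintype.card_subtype]
    refine (Fintype.card_of_bijective
      (f := fun σ : T ≃g T => (⟨g.comp σ.toCopy, ?_⟩ :
        {f : SimpleGraph.Copy T G // f.toSubgraph = C})) ⟨?_, ?_⟩).symm
    · ext x y
      · simp only [SimpleGraph.Subgraph.map_verts, SimpleGraph.Subgraph.verts_top, Set.image_univ,
          Set.mem_range]
        constructor
        · rintro ⟨a, rfl⟩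
          exact (e (σ a)).2
        · intro hx
          exact ⟨σ.symm (e.symm ⟨x, hx⟩), by
            change ((e (σ (σ.symm (e.symm ⟨x, hx⟩))) : C.verts) : V) = x
            simp⟩
      · simp only [SimpleGraph.Subgraph.map_adj, Relation.Map, SimpleGraph.Subgraph.top_adj]
        constructor
        · rintro ⟨a, b, hab, rfl, rfl⟩
          have := e.map_rel_iff.2 (σ.map_rel_iff.2 hab)
          exact this
        · intro hxy
          have hx := C.edge_vert hxy
          have hy := C.edge_vert hxy.symm
          refine ⟨σ.symm (e.symm ⟨x, hx⟩), σ.symm (e.symm ⟨y, hy⟩), ?_, ?_, ?_⟩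
          · rw [σ.symm.map_rel_iff, e.symm.map_rel_iff]
            exact hxy
          · change ((e (σ (σ.symm (e.symm ⟨x, hx⟩))) : C.verts) : V) = x
            simp
          · change ((e (σ (σ.symm (e.symm ⟨y, hy⟩))) : C.verts) : V) = y
            simp
    · intro σ τ h
      have h' := congrArg Subtype.val h
      ext a
      have h2 : g (σ a) = g (τ a) := DFunLike.congr_fun h' a
      exact g.injective h2
    · rintro ⟨f, hf⟩
      have hmem : ∀ a, f a ∈ C.verts := by
        intro a
        rw [← hf]
        exact ⟨a, trivial, rfl⟩
      have hadj : ∀ a b, C.Adj (f a) (f b) ↔ T.Adj a b := by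
        intro a b
        rw [← hf]
        simp only [SimpleGraph.Subgraph.map_adj, Relation.Map, SimpleGraph.Subgraph.top_adj]
        constructor
        · rintro ⟨a', b', h, h1, h2⟩
          rwa [← f.injective h1, ← f.injective h2]
        · intro h
          exact ⟨a, b, h, rfl, rfl⟩
      let σ : W → W := fun a => e.symm ⟨f a, hmem a⟩
      have hσ : Function.Injective σ := by
        intro a b h
        have := e.symm.injective h
        exact f.injective (congrArg Subtype.val this)
      refine ⟨⟨Equiv.ofBijective σ (Finite.injective_iff_bijective.1 hσ), ?_⟩, ?_⟩
      · intro a b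
        change T.Adj (e.symm ⟨f a, hmem a⟩) (e.symm ⟨f b, hmem b⟩) ↔ _
        rw [e.symm.map_rel_iff]
        exact hadj a b
      · apply Subtype.ext
        ext a
        change ((e (e.symm ⟨f a, hmem a⟩) : C.verts) : V) = f a
        simp
  have := Finset.card_eq_sum_card_fiberwise (s := (Finset.univ : Finset (SimpleGraph.Copy T G)))
    (t := (Finset.univ.filter fun C : G.Subgraph => Nonempty (T ≃g C.coe)))
    (f := fun f => f.toSubgraph) (by
      intro f _
      simp only [Finset.coe_filter, Finset.mem_univ, true_and, Set.mem_ofPred_eq]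
      exact ⟨f.isoToSubgraph⟩)
  rw [Finset.sum_congr rfl hfib, Finset.sum_const, smul_eq_mul] at this
  rw [labelledCopyCount_eq_natCard, SimpleGraph.copyCount, Nat.card_eq_fintype_card,
    ← Finset.card_univ, this]

/-- The number of ordered pairs of adjacent vertices. -/
noncomputable def adjPairCount {V : Type*} (G : SimpleGraph V) : ℕ :=
  Nat.card {p : V × V // G.Adj p.1 p.2}

open Classical in
/-- In an arc-transitive graph, a subgraph has at most its proportional share of copies. -/
theorem copyCount_mul_adjPairCount_le {V W : Type*} [Fintype V] [Fintype W]
    {Q G : SimpleGraph V} {T : SimpleGraph W} (hGQ : G ≤ Q)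
    (htrans : ∀ u v u' v', Q.Adj u v → Q.Adj u' v' → ∃ φ : Q ≃g Q, φ u = u' ∧ φ v = v')
    {a b : W} (hab : T.Adj a b) :
    G.copyCount T * adjPairCount Q ≤ Q.copyCount T * adjPairCount G := by
  -- By arc-transitivity, the number of labelled copies that send `(a, b)` to a given arc of `Q` is
  -- the same for all arcs; one inequality suffices by symmetry.
  have hmono : ∀ p q : V × V, Q.Adj p.1 p.2 → Q.Adj q.1 q.2 →
      (Finset.univ.filter fun f : SimpleGraph.Copy T Q => (f a, f b) = p).card ≤
      (Finset.univ.filter fun f : SimpleGraph.Copy T Q => (f a, f b) = q).card := by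
    rintro ⟨u, v⟩ ⟨u', v'⟩ h h'
    obtain ⟨φ, h1, h2⟩ := htrans u v u' v' h h'
    refine Finset.card_le_card_of_injOn (fun f => φ.toCopy.comp f) ?_ ?_
    · intro f hf
      simp only [Finset.coe_filter, Finset.mem_univ, true_and, Set.mem_ofPred_eq,
        Prod.mk.injEq] at hf ⊢
      refine ⟨?_, ?_⟩
      · change φ (f a) = u'
        rw [hf.1, h1]
      · change φ (f b) = v'
        rw [hf.2, h2]
    · intro f _ g _ hfg
      ext x
      exact φ.injective (DFunLike.congr_fun hfg x)
  have hQ : Q.labelledCopyCount T = ∑ p ∈ Finset.univ.filter (fun p : V × V => Q.Adj p.1 p.2),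
      (Finset.univ.filter fun f : SimpleGraph.Copy T Q => (f a, f b) = p).card := by
    have := Finset.card_eq_sum_card_fiberwise (s := (Finset.univ : Finset (SimpleGraph.Copy T Q)))
      (t := Finset.univ.filter (fun p : V × V => Q.Adj p.1 p.2))
      (f := fun f => (f a, f b)) (by
        intro f _
        simp only [Finset.coe_filter, Finset.mem_univ, true_and, Set.mem_ofPred_eq]
        exact f.toHom.map_adj hab)
    rw [← this, labelledCopyCount_eq_natCard, Nat.card_eq_fintype_card, Finset.card_univ]
  have hG : G.labelledCopyCount T ≤ ∑ p ∈ Finset.univ.filter (fun p : V × V => G.Adj p.1 p.2),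
      (Finset.univ.filter fun f : SimpleGraph.Copy T Q => (f a, f b) = p).card := by
    have := Finset.card_eq_sum_card_fiberwise (s := (Finset.univ : Finset (SimpleGraph.Copy T G)))
      (t := Finset.univ.filter (fun p : V × V => G.Adj p.1 p.2))
      (f := fun f => (f a, f b)) (by
        intro f _
        simp only [Finset.coe_filter, Finset.mem_univ, true_and, Set.mem_ofPred_eq]
        exact f.toHom.map_adj hab)
    have e : G.labelledCopyCount T = (Finset.univ : Finset (SimpleGraph.Copy T G)).card := by
      rw [labelledCopyCount_eq_natCard, Nat.card_eq_fintype_card, Finset.card_univ]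
    rw [e, this]
    refine Finset.sum_le_sum fun p _ => ?_
    refine Finset.card_le_card_of_injOn
      (fun f => (SimpleGraph.Copy.ofLE G Q hGQ).comp f) ?_ ?_
    · intro f hf
      simpa using hf
    · intro f _ g _ hfg
      ext x
      exact DFunLike.congr_fun hfg x
  have hcard : ∀ H : SimpleGraph V, adjPairCount H =
      (Finset.univ.filter (fun p : V × V => H.Adj p.1 p.2)).card := by
    intro H
    rw [adjPairCount, Nat.card_eq_fintype_card, Fintype.card_subtype]
  have haut : 0 < Nat.card (T ≃g T) := by
    have : Finite (T ≃g T) := Finite.of_injective (fun e => (e : W → W)) DFunLike.coe_injective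
    have : Nonempty (T ≃g T) := ⟨SimpleGraph.Iso.refl⟩
    exact Nat.card_pos
  refine Nat.le_of_mul_le_mul_right ?_ haut
  have : G.labelledCopyCount T * adjPairCount Q ≤ Q.labelledCopyCount T * adjPairCount G := by
    rw [hQ, hcard, hcard]
    refine (Nat.mul_le_mul_right _ hG).trans ?_
    rw [Finset.card_eq_sum_ones, Finset.card_eq_sum_ones, Finset.sum_mul_sum, Finset.sum_mul_sum,
      Finset.sum_comm]
    refine Finset.sum_le_sum fun q hq => Finset.sum_le_sum fun p hp => ?_
    rw [Finset.mem_filter] at hp hq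
    simpa using hmono p q (hGQ hp.2) hq.2
  calc _ = G.labelledCopyCount T * adjPairCount Q := by
        rw [labelledCopyCount_eq_copyCount_mul]; ring
    _ ≤ _ := this
    _ = _ := by rw [labelledCopyCount_eq_copyCount_mul]; ring

/-! ### Dependent random choice and even cycles with a pendant edge -/

/-- Dependent random choice with two random vertices: a graph with many edges has `m` vertices
every two of which have more than `s` common neighbours. -/
theorem exists_finset_many_common_neighbors {α : Type*} [Fintype α] [DecidableEq α]
    (B : SimpleGraph α) [DecidableRel B.Adj] (s m : ℕ)
    (hE : Fintype.card α ^ 3 * (m + s ^ 2) < (∑ z, B.degree z) ^ 2) :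
    ∃ U : Finset α, U.card = m ∧ ∀ u ∈ U, ∀ w ∈ U, u ≠ w →
      s < (Finset.univ.filter fun z => B.Adj u z ∧ B.Adj w z).card := by
  set n := Fintype.card α with hn
  let A : α × α → Finset α := fun q => Finset.univ.filter fun z => B.Adj q.1 z ∧ B.Adj q.2 z
  let bad : α × α → Finset (α × α) := fun q => Finset.univ.filter fun p =>
    (p.1 ≠ p.2 ∧ (A p).card ≤ s) ∧ (B.Adj q.1 p.1 ∧ B.Adj q.1 p.2) ∧
      (B.Adj q.2 p.1 ∧ B.Adj q.2 p.2)
  have hA : ∑ q, (A q).card = ∑ z, B.degree z ^ 2 := by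
    have := Finset.sum_card_bipartiteAbove_eq_sum_card_bipartiteBelow
      (s := (Finset.univ : Finset (α × α))) (t := (Finset.univ : Finset α))
      (fun q z => B.Adj q.1 z ∧ B.Adj q.2 z)
    refine this.trans (Finset.sum_congr rfl fun z _ => ?_)
    have e : Finset.univ.bipartiteBelow (fun (q : α × α) z => B.Adj q.1 z ∧ B.Adj q.2 z) z =
        B.neighborFinset z ×ˢ B.neighborFinset z := by
      ext q
      simp [Finset.mem_bipartiteBelow, B.adj_comm z]
    rw [e, Finset.card_product, SimpleGraph.card_neighborFinset_eq_degree, sq]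
  -- A pair `p` with few common neighbours is bad only for those `q` with both entries in `A p`, so
  -- for at most `s ^ 2` choices of `q`.
  have hbad : ∑ q, (bad q).card ≤ n ^ 2 * s ^ 2 := by
    have := Finset.sum_card_bipartiteAbove_eq_sum_card_bipartiteBelow
      (s := (Finset.univ : Finset (α × α))) (t := (Finset.univ : Finset (α × α)))
      (fun q p => (p.1 ≠ p.2 ∧ (A p).card ≤ s) ∧ (B.Adj q.1 p.1 ∧ B.Adj q.1 p.2) ∧
      (B.Adj q.2 p.1 ∧ B.Adj q.2 p.2))
    refine this.trans_le ?_
    have hc : (Finset.univ : Finset (α × α)).card = n ^ 2 := by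
      rw [Finset.card_univ, Fintype.card_prod, sq]
    rw [← hc, ← smul_eq_mul]
    refine Finset.sum_le_card_nsmul _ _ _ fun p _ => ?_
    by_cases hp : p.1 ≠ p.2 ∧ (A p).card ≤ s
    · refine le_trans ?_ (Nat.pow_le_pow_left hp.2 2)
      rw [sq, ← Finset.card_product]
      refine Finset.card_le_card fun q hq => ?_
      simp only [Finset.mem_bipartiteBelow, Finset.mem_univ, true_and] at hq
      simp only [A, Finset.mem_product, Finset.mem_filter, Finset.mem_univ, true_and]
      exact ⟨⟨hq.2.1.1.symm, hq.2.1.2.symm⟩, ⟨hq.2.2.1.symm, hq.2.2.2.symm⟩⟩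
    · refine le_trans (le_of_eq ?_) (Nat.zero_le _)
      rw [Finset.card_eq_zero, Finset.eq_empty_iff_forall_notMem]
      intro q hq
      rw [Finset.mem_bipartiteBelow] at hq
      exact hp hq.2.1
  obtain ⟨q, hq⟩ : ∃ q, m + (bad q).card < (A q).card := by
    by_contra! hcon
    have h1 : ∑ z, B.degree z ^ 2 ≤ n ^ 2 * m + n ^ 2 * s ^ 2 := by
      rw [← hA]
      refine (Finset.sum_le_sum fun q _ => hcon q).trans ?_
      rw [Finset.sum_add_distrib, Finset.sum_const, Finset.card_univ, Fintype.card_prod,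
        smul_eq_mul, ← sq]
      exact Nat.add_le_add_left hbad _
    have h2 : (∑ z, B.degree z) ^ 2 ≤ n * ∑ z, B.degree z ^ 2 := by
      have := sq_sum_le_card_mul_sum_sq (s := (Finset.univ : Finset α)) (f := fun z => B.degree z)
      rwa [Finset.card_univ] at this
    have h3 : n * ∑ z, B.degree z ^ 2 ≤ n * (n ^ 2 * m + n ^ 2 * s ^ 2) :=
      Nat.mul_le_mul_left _ h1
    have h4 : n * (n ^ 2 * m + n ^ 2 * s ^ 2) = n ^ 3 * (m + s ^ 2) := by ring
    omega
  -- Deleting the first entry of each bad pair destroys all bad pairs and still leaves `m` vertices.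
  have hle : m ≤ (A q \ (bad q).image Prod.fst).card := by
    have h1 := Finset.le_card_sdiff ((bad q).image Prod.fst) (A q)
    have h2 : ((bad q).image Prod.fst).card ≤ (bad q).card := Finset.card_image_le
    omega
  obtain ⟨U, hU, hUm⟩ := Finset.exists_subset_card_eq hle
  refine ⟨U, hUm, fun u hu w hw huw => ?_⟩
  by_contra! hs
  have hu' := Finset.mem_sdiff.1 (hU hu)
  have hw' := Finset.mem_sdiff.1 (hU hw)
  refine hu'.2 (Finset.mem_image.2 ⟨(u, w), ?_, rfl⟩)
  simp only [A, Finset.mem_filter, Finset.mem_univ, true_and] at hu' hw'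
  simp only [bad, Finset.mem_filter, Finset.mem_univ, true_and]
  exact ⟨⟨huw, hs⟩, ⟨hu'.1.1, hw'.1.1⟩, ⟨hu'.1.2, hw'.1.2⟩⟩

/-- A graph with many edges contains a cycle of length `2 m` with a pendant edge. -/
theorem exists_even_cycle_with_pendant {α : Type*} [Fintype α] [DecidableEq α]
    (B : SimpleGraph α) [DecidableRel B.Adj] (m : ℕ) (hm : 2 ≤ m)
    (hE : Fintype.card α ^ 3 * (m + (2 * m) ^ 2) < (∑ z, B.degree z) ^ 2) :
    ∃ (c : ℕ → α) (y : α), c (2 * m) = c 0 ∧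
      (∀ i < 2 * m, ∀ j < 2 * m, c i = c j → i = j) ∧
      (∀ i < 2 * m, B.Adj (c i) (c (i + 1))) ∧ B.Adj (c 0) y ∧ ∀ i < 2 * m, c i ≠ y := by
  obtain ⟨U, hUm, hU⟩ := exists_finset_many_common_neighbors B (2 * m) m hE
  have hm0 : 0 < m := by omega
  let e := (U.equivFinOfCardEq hUm).symm
  let u : ℕ → α := fun i => e ⟨i % m, Nat.mod_lt _ hm0⟩
  have huU : ∀ i, u i ∈ U := fun i => (e _).2
  have huinj : ∀ i j, u i = u j → i % m = j % m := by
    intro i j h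
    have := e.injective (Subtype.ext h)
    simpa using this
  have hune : ∀ i, u i ≠ u (i + 1) := by
    intro i h
    have h1 := huinj _ _ h
    have h2 : (i + 1) % m = (i % m + 1) % m := by simp
    have h3 := Nat.mod_lt i hm0
    rcases Nat.lt_or_ge (i % m + 1) m with h4 | h4
    · rw [Nat.mod_eq_of_lt h4] at h2
      omega
    · have h5 : i % m + 1 = m := by omega
      rw [h5, Nat.mod_self] at h2
      omega
  -- Indices of `u` are cyclic modulo `m`, so the last set `t m` repeats the pair `u 0, u 1`. Its
  -- representative is the extra vertex that becomes the pendant one.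
  let t : Fin (m + 1) → Finset α := fun i =>
    (Finset.univ.filter fun z => B.Adj (u i) z ∧ B.Adj (u (i + 1)) z) \ U
  have ht : ∀ i, m + 1 ≤ (t i).card := by
    intro i
    have h1 := hU _ (huU i) _ (huU (i + 1)) (hune i)
    have h2 := Finset.le_card_sdiff U
      (Finset.univ.filter fun z => B.Adj (u i) z ∧ B.Adj (u (i + 1)) z)
    change m + 1 ≤ ((Finset.univ.filter fun z => B.Adj (u i) z ∧ B.Adj (u (i + 1)) z) \ U).card
    omega
  -- Hall's condition is immediate: each of the `m + 1` sets has at least `m + 1` elements, since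
  -- removing `U` costs at most `m` out of more than `2 * m`.
  obtain ⟨w, hwinj, hw⟩ := (Finset.all_card_le_biUnion_card_iff_exists_injective t).1 (by
    intro s
    rcases s.eq_empty_or_nonempty with rfl | ⟨i, hi⟩
    · simp
    · have h1 : s.card ≤ m + 1 := by simpa using Finset.card_le_univ s
      exact h1.trans ((ht i).trans (Finset.card_le_card (Finset.subset_biUnion_of_mem t hi))))
  have hw' : ∀ i : Fin (m + 1), (B.Adj (u i) (w i) ∧ B.Adj (u (i + 1)) (w i)) ∧ w i ∉ U := by
    intro i
    simpa [t] using hw i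
  let W : ℕ → α := fun i => w (Fin.ofNat (m + 1) i)
  have hval : ∀ i ≤ m, ((Fin.ofNat (m + 1) i : Fin (m + 1)) : ℕ) = i := by
    intro i hi
    simp [Fin.ofNat, Nat.mod_eq_of_lt (Nat.lt_succ_of_le hi)]
  have hW : ∀ i ≤ m, B.Adj (u i) (W i) ∧ B.Adj (u (i + 1)) (W i) := by
    intro i hi
    have := (hw' (Fin.ofNat (m + 1) i)).1
    rwa [hval i hi] at this
  have hWU : ∀ i, W i ∉ U := fun i => (hw' _).2
  have hWinj : ∀ i ≤ m, ∀ j ≤ m, W i = W j → i = j := by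
    intro i hi j hj h
    have := congrArg Fin.val (hwinj h)
    rwa [hval i hi, hval j hj] at this
  have hu0 : u m = u 0 := by simp [u]
  have huW : ∀ i j, u i ≠ W j := fun i j h => hWU j (h ▸ huU i)
  refine ⟨fun j => if j % 2 = 0 then u (j / 2) else W (j / 2), W m, ?_, ?_, ?_, ?_, ?_⟩
  · simpa using hu0
  · intro i hi j hj h
    have hi2 : i / 2 < m := by omega
    have hj2 : j / 2 < m := by omega
    simp only at h
    split_ifs at h with h1 h2 h2
    · have := huinj _ _ h
      rw [Nat.mod_eq_of_lt hi2, Nat.mod_eq_of_lt hj2] at this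
      omega
    · exact absurd h (huW _ _)
    · exact absurd h.symm (huW _ _)
    · have := hWinj _ hi2.le _ hj2.le h
      omega
  · intro i hi
    have hi2 : i / 2 < m := by omega
    simp only
    rcases Nat.mod_two_eq_zero_or_one i with h1 | h1
    · have h2 : (i + 1) % 2 ≠ 0 := by omega
      have h3 : (i + 1) / 2 = i / 2 := by omega
      rw [if_pos h1, if_neg h2, h3]
      exact (hW _ hi2.le).1
    · have h2 : (i + 1) % 2 = 0 := by omega
      have h3 : (i + 1) / 2 = i / 2 + 1 := by omega
      rw [if_neg (by omega), if_pos h2, h3]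
      exact (hW _ hi2.le).2.symm
  · have := (hW m le_rfl).1
    rw [hu0] at this
    simpa using this
  · intro i hi h
    have hi2 : i / 2 < m := by omega
    simp only at h
    split_ifs at h with h1
    · exact huW _ _ h
    · have := hWinj _ hi2.le _ le_rfl h
      omega

/-! ### Lifting cycles from links to the graph on sets -/

/-- In a graph on finite sets, the set `{x, u, v}` has three elements and is adjacent to all its
subsets of size two. -/
def FullTriple {α : Type*} [DecidableEq α] (H : SimpleGraph (Finset α)) (x u v : α) : Prop :=
  (x ≠ u ∧ x ≠ v ∧ u ≠ v) ∧
    H.Adj {x, u, v} {x, u} ∧ H.Adj {x, u, v} {x, v} ∧ H.Adj {x, u, v} {u, v}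

theorem FullTriple.swap {α : Type*} [DecidableEq α] {H : SimpleGraph (Finset α)} {x u v : α}
    (h : FullTriple H x u v) : FullTriple H x v u := by
  obtain ⟨⟨h1, h2, h3⟩, h4, h5, h6⟩ := h
  refine ⟨⟨h2, h1, h3.symm⟩, ?_, ?_, ?_⟩
  · rwa [Finset.pair_comm v u]
  · rwa [Finset.pair_comm v u]
  · rwa [Finset.pair_comm v u]

/-- The closed sequence of sets of sizes two and three that follows the sequence `c` in the link
of `x`. -/
def linkSeq {α : Type*} [DecidableEq α] (x : α) (c : ℕ → α) (j : ℕ) : Finset α :=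
  {x, c (j / 2), c ((j + 1) / 2)}

section LinkSeq

variable {α : Type*} [DecidableEq α] {H : SimpleGraph (Finset α)} {x : α} {c : ℕ → α} {m : ℕ}

theorem linkSeq_two_mul (x : α) (c : ℕ → α) (i : ℕ) : linkSeq x c (2 * i) = {x, c i} := by
  have h1 : 2 * i / 2 = i := by omega
  have h2 : (2 * i + 1) / 2 = i := by omega
  rw [linkSeq, h1, h2]
  simp

theorem linkSeq_two_mul_add_one (x : α) (c : ℕ → α) (i : ℕ) :
    linkSeq x c (2 * i + 1) = {x, c i, c (i + 1)} := by
  have h1 : (2 * i + 1) / 2 = i := by omega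
  have h2 : (2 * i + 1 + 1) / 2 = i + 1 := by omega
  rw [linkSeq, h1, h2]

theorem linkSeq_adj (hc : ∀ i < 2 * m, FullTriple H x (c i) (c (i + 1))) {j : ℕ}
    (hj : j < 4 * m) : H.Adj (linkSeq x c j) (linkSeq x c (j + 1)) := by
  obtain ⟨i, rfl | rfl⟩ := Nat.even_or_odd' j
  · rw [linkSeq_two_mul, linkSeq_two_mul_add_one]
    exact (hc i (by omega)).2.1.symm
  · rw [linkSeq_two_mul_add_one, show 2 * i + 1 + 1 = 2 * (i + 1) by ring, linkSeq_two_mul]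
    exact (hc i (by omega)).2.2.1

omit [DecidableEq α] in
theorem eq_or_of_cyclic_eq (hper : c (2 * m) = c 0)
    (hinj : ∀ i < 2 * m, ∀ j < 2 * m, c i = c j → i = j) {a b : ℕ} (ha : a ≤ 2 * m)
    (hb : b ≤ 2 * m) (h : c a = c b) :
    a = b ∨ (a = 0 ∧ b = 2 * m) ∨ (a = 2 * m ∧ b = 0) := by
  rcases ha.lt_or_eq with ha' | rfl <;> rcases hb.lt_or_eq with hb' | rfl
  · exact Or.inl (hinj _ ha' _ hb' h)
  · rcases Nat.eq_zero_or_pos m with rfl | hm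
    · omega
    · have := hinj _ ha' 0 (by omega) (h.trans hper)
      omega
  · rcases Nat.eq_zero_or_pos m with rfl | hm
    · omega
    · have := hinj 0 (by omega) _ hb' (hper.symm.trans h)
      omega
  · exact Or.inl rfl

/-- Since `x` avoids the cycle, removing it from a term leaves a vertex or an edge of the cycle `c`.
As `c` has length at least four, these determine the index up to the identification of the two ends.
-/
theorem linkSeq_injective (hm : 2 ≤ m) (hper : c (2 * m) = c 0)
    (hinj : ∀ i < 2 * m, ∀ j < 2 * m, c i = c j → i = j) (hx : ∀ i ≤ 2 * m, x ≠ c i) {i j : ℕ}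
    (hi : i ≤ 4 * m) (hj : j ≤ 4 * m) (h : linkSeq x c i = linkSeq x c j) :
    i = j ∨ (i = 0 ∧ j = 4 * m) ∨ (i = 4 * m ∧ j = 0) := by
  have key : ∀ i j, i ≤ 4 * m → j ≤ 4 * m → linkSeq x c i = linkSeq x c j → ∀ a ≤ 2 * m,
      (a = i / 2 ∨ a = (i + 1) / 2) → c a = c (j / 2) ∨ c a = c ((j + 1) / 2) := by
    intro i j hi hj h a ha hai
    have h1 : c a ∈ linkSeq x c j := by
      rw [← h, linkSeq]
      rcases hai with rfl | rfl <;> simp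
    rw [linkSeq] at h1
    simpa [(hx a ha).symm] using h1
  have fin : ∀ a ≤ 2 * m, ∀ b ≤ 2 * m, c a = c b →
      a = b ∨ (a = 0 ∧ b = 2 * m) ∨ (a = 2 * m ∧ b = 0) :=
    fun a ha b hb h => eq_or_of_cyclic_eq hper hinj ha hb h
  have k1 := key i j hi hj h (i / 2) (by omega) (Or.inl rfl)
  have k2 := key i j hi hj h ((i + 1) / 2) (by omega) (Or.inr rfl)
  have k3 := key j i hj hi h.symm (j / 2) (by omega) (Or.inl rfl)
  have k4 := key j i hj hi h.symm ((j + 1) / 2) (by omega) (Or.inr rfl)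
  replace k1 := k1.imp (fin _ (by omega) _ (by omega)) (fin _ (by omega) _ (by omega))
  replace k2 := k2.imp (fin _ (by omega) _ (by omega)) (fin _ (by omega) _ (by omega))
  replace k3 := k3.imp (fin _ (by omega) _ (by omega)) (fin _ (by omega) _ (by omega))
  replace k4 := k4.imp (fin _ (by omega) _ (by omega)) (fin _ (by omega) _ (by omega))
  obtain ⟨a, rfl | rfl⟩ := Nat.even_or_odd' i <;> obtain ⟨b, rfl | rfl⟩ := Nat.even_or_odd' j
  · rw [show 2 * a / 2 = a by omega, show (2 * a + 1) / 2 = a by omega,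
      show 2 * b / 2 = b by omega, show (2 * b + 1) / 2 = b by omega] at *
    omega
  · rw [show 2 * a / 2 = a by omega, show (2 * a + 1) / 2 = a by omega,
      show (2 * b + 1) / 2 = b by omega, show (2 * b + 1 + 1) / 2 = b + 1 by omega] at *
    omega
  · rw [show (2 * a + 1) / 2 = a by omega, show (2 * a + 1 + 1) / 2 = a + 1 by omega,
      show 2 * b / 2 = b by omega, show (2 * b + 1) / 2 = b by omega] at *
    omega
  · rw [show (2 * a + 1) / 2 = a by omega, show (2 * a + 1 + 1) / 2 = a + 1 by omega,
      show (2 * b + 1) / 2 = b by omega, show (2 * b + 1 + 1) / 2 = b + 1 by omega] at *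
    omega

open SimpleGraph in
/-- A cycle of length `2 m` in the link of `x` gives a cycle of length `4 m`. -/
theorem cycleGraph_four_mul_isContained (hm : 2 ≤ m) (hper : c (2 * m) = c 0)
    (hinj : ∀ i < 2 * m, ∀ j < 2 * m, c i = c j → i = j)
    (hc : ∀ i < 2 * m, FullTriple H x (c i) (c (i + 1))) :
    cycleGraph (4 * m) ⊑ H := by
  have hx : ∀ i ≤ 2 * m, x ≠ c i := by
    intro i hi
    rcases hi.lt_or_eq with h | rfl
    · exact (hc i h).1.1
    · rw [hper]
      exact (hc 0 (by omega)).1.1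
  obtain ⟨F, -⟩ := exists_copy_cycleGraph (H := H) (N := 4 * m) (linkSeq x c)
    (fun i hi j hj h => by
      have := linkSeq_injective hm hper hinj hx hi.le hj.le h
      omega)
    (fun i hi => linkSeq_adj hc (by omega))
    (by
      have h1 := linkSeq_adj hc (show 4 * m - 1 < 4 * m by omega)
      have h2 : linkSeq x c (4 * m) = linkSeq x c 0 := by
        rw [show 4 * m = 2 * (2 * m) by ring, show 0 = 2 * 0 by rfl, linkSeq_two_mul,
          linkSeq_two_mul, hper]
      rwa [show 4 * m - 1 + 1 = 4 * m by omega, h2] at h1)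
  exact ⟨F⟩

set_option linter.unusedSimpArgs false in
open SimpleGraph in
/-- A cycle of length `2 m` with a pendant edge in the common link of `x` and `x'` gives a cycle of
length `4 m + 6`. -/
theorem cycleGraph_four_mul_add_six_isContained {x' y : α} (hxx' : x ≠ x') (hm : 2 ≤ m)
    (hper : c (2 * m) = c 0) (hinj : ∀ i < 2 * m, ∀ j < 2 * m, c i = c j → i = j)
    (hyc : ∀ i < 2 * m, c i ≠ y)
    (hc : ∀ i < 2 * m, FullTriple H x (c i) (c (i + 1)))
    (hc' : ∀ i < 2 * m, FullTriple H x' (c i) (c (i + 1)))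
    (hy : FullTriple H x (c 0) y) (hy' : FullTriple H x' (c 0) y) :
    cycleGraph (4 * m + 6) ⊑ H := by
  have hx' : ∀ i ≤ 2 * m, x' ≠ c i := by
    intro i hi
    rcases hi.lt_or_eq with h | rfl
    · exact (hc' i h).1.1
    · rw [hper]
      exact hy'.1.1
  have hyc' : ∀ i ≤ 2 * m, c i ≠ y := by
    intro i hi
    rcases hi.lt_or_eq with h | rfl
    · exact hyc i h
    · rw [hper]
      exact hyc 0 (by omega)
  have hc0 := hc 0 (by omega)
  have hc0' := hc' 0 (by omega)
  simp only [zero_add] at hc0 hc0'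
  have h01 : c 0 ≠ c 1 := hc0.1.2.2
  have hxc0 : x ≠ c 0 := hc0.1.1
  have hxc1 : x ≠ c 1 := hc0.1.2.1
  have hx'c0 : x' ≠ c 0 := hc0'.1.1
  have hx'c1 : x' ≠ c 1 := hc0'.1.2.1
  have hxy : x ≠ y := hy.1.2.1
  have hx'y : x' ≠ y := hy'.1.2.1
  have hy0 : c 0 ≠ y := hy.1.2.2
  have hy1 : c 1 ≠ y := hyc 1 (by omega)
  -- The detour replacing the edge from `{x', c 0}` to `{x', c 0, c 1}` of the lifted cycle at `x'`.
  -- It leaves through `y`, passes the link of `x` and returns through `{c 0, c 1}`, adding six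
  -- vertices.
  let g : ℕ → Finset α := fun i => if i = 0 then {x', c 0, y} else if i = 1 then {c 0, y} else
    if i = 2 then {x, c 0, y} else if i = 3 then {x, c 0} else if i = 4 then {x, c 0, c 1} else
    {c 0, c 1}
  have hmem : ∀ j, x' ∈ linkSeq x' c j := by
    intro j
    simp [linkSeq]
  have hymem : ∀ j ≤ 4 * m, y ∉ linkSeq x' c j := by
    intro j hj
    simp [linkSeq, hx'y.symm, (hyc' (j / 2) (by omega)).symm,
      (hyc' ((j + 1) / 2) (by omega)).symm]
  have hg0 : y ∈ g 0 := by simp [g]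
  have hgx' : ∀ i < 6, i ≠ 0 → x' ∉ g i := by
    intro i hi hi0
    interval_cases i <;> first | exact absurd rfl hi0 | simp [g, hxx', hxx'.symm, h01, h01.symm, hxc0, hxc0.symm, hxc1, hxc1.symm, hx'c0, hx'c0.symm,
        hx'c1, hx'c1.symm, hxy, hxy.symm, hx'y, hx'y.symm, hy0, hy0.symm, hy1, hy1.symm]
  -- All terms of the lifted cycle contain `x'` and none contains `y`; on the detour only `g 0`
  -- contains `x'`, and it contains `y`.
  have hlg : ∀ j ≤ 4 * m, ∀ i < 6, linkSeq x' c j ≠ g i := by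
    intro j hj i hi h
    by_cases hi0 : i = 0
    · subst hi0
      exact hymem j hj (h ▸ hg0)
    · exact hgx' i hi hi0 (h ▸ hmem j)
  -- Membership of `x`, `y`, `c 1` and `x'` tells the six sets apart.
  have hginj : ∀ i < 6, ∀ j < 6, g i = g j → i = j := by
    have s0 : x' ∈ g 0 := by simp [g]
    have s1 : ∀ i < 6, x ∈ g i ↔ (i = 2 ∨ i = 3 ∨ i = 4) := by
      intro i hi
      interval_cases i <;> simp [g, hxx', hxx'.symm, h01, h01.symm, hxc0, hxc0.symm, hxc1, hxc1.symm, hx'c0, hx'c0.symm,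
        hx'c1, hx'c1.symm, hxy, hxy.symm, hx'y, hx'y.symm, hy0, hy0.symm, hy1, hy1.symm]
    have s2 : ∀ i < 6, y ∈ g i ↔ (i = 0 ∨ i = 1 ∨ i = 2) := by
      intro i hi
      interval_cases i <;> simp [g, hxx', hxx'.symm, h01, h01.symm, hxc0, hxc0.symm, hxc1, hxc1.symm, hx'c0, hx'c0.symm,
        hx'c1, hx'c1.symm, hxy, hxy.symm, hx'y, hx'y.symm, hy0, hy0.symm, hy1, hy1.symm]
    have s3 : ∀ i < 6, c 1 ∈ g i ↔ (i = 4 ∨ i = 5) := by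
      intro i hi
      interval_cases i <;> simp [g, hxx', hxx'.symm, h01, h01.symm, hxc0, hxc0.symm, hxc1, hxc1.symm, hx'c0, hx'c0.symm,
        hx'c1, hx'c1.symm, hxy, hxy.symm, hx'y, hx'y.symm, hy0, hy0.symm, hy1, hy1.symm]
    have s4 : ∀ i < 6, x' ∈ g i ↔ i = 0 := by
      intro i hi
      constructor
      · intro h
        by_contra h0
        exact hgx' i hi h0 h
      · rintro rfl
        exact s0
    intro i hi j hj h
    have t1 := s1 i hi
    have t2 := s2 i hi
    have t3 := s3 i hi
    have t4 := s4 i hi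
    rw [h] at t1 t2 t3 t4
    rw [s1 j hj] at t1
    rw [s2 j hj] at t2
    rw [s3 j hj] at t3
    rw [s4 j hj] at t4
    omega
  have hgadj : ∀ i < 5, H.Adj (g i) (g (i + 1)) := by
    intro i hi
    interval_cases i
    · exact hy'.2.2.2
    · exact hy.2.2.2.symm
    · exact hy.2.1
    · exact hc0.2.1.symm
    · exact hc0.2.2.2
  -- The shift by one starts the cycle at `{x', c 0, c 1}`, so that its lifted part ends at `{x', c
  -- 0}`, where the detour begins.
  obtain ⟨F, -⟩ := exists_copy_cycleGraph (H := H) (N := 4 * m + 6)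
    (fun j => if j < 4 * m then linkSeq x' c (j + 1) else g (j - 4 * m))
    (fun i hi j hj h => by
      split_ifs at h with h1 h2 h2
      · have := linkSeq_injective hm hper hinj hx' (by omega) (by omega) h
        omega
      · exact absurd h (hlg _ (by omega) _ (by omega))
      · exact absurd h.symm (hlg _ (by omega) _ (by omega))
      · have := hginj _ (by omega) _ (by omega) h
        omega)
    (fun i hi => by
      rcases lt_trichotomy (i + 1) (4 * m) with h1 | h1 | h1
      · rw [if_pos (by omega), if_pos h1]
        exact linkSeq_adj hc' (by omega)
      · rw [if_pos (by omega), if_neg (by omega), h1, Nat.sub_self,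
          show 4 * m = 2 * (2 * m) by ring, linkSeq_two_mul, hper]
        exact hy'.2.1.symm
      · rw [if_neg (by omega), if_neg (by omega),
          show i + 1 - 4 * m = i - 4 * m + 1 by omega]
        exact hgadj _ (by omega))
    (by
      rw [if_neg (by omega), if_pos (by omega), show 4 * m + 6 - 1 - 4 * m = 5 by omega,
        show 0 + 1 = 2 * 0 + 1 by rfl, linkSeq_two_mul_add_one]
      exact hc0'.2.2.2.symm)
  exact ⟨F⟩

end LinkSeq

/-! ### Base vertices, edge directions and full triples -/

/-- The vertex of the hypercube obtained from `S` by flipping the coordinates in `K`. -/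
def flipOn {n : ℕ} (S : Fin n → Bool) (K : Finset (Fin n)) : Fin n → Bool :=
  fun i => xor (S i) (decide (i ∈ K))

theorem flipOn_injective {n : ℕ} (S : Fin n → Bool) : Function.Injective (flipOn S) := by
  intro K L h
  ext i
  have := congrFun h i
  simpa [flipOn] using this

theorem flipOn_flipOn_self {n : ℕ} (S : Fin n → Bool) (K : Finset (Fin n)) :
    flipOn (flipOn S K) K = S := by
  funext i
  simp [flipOn]

theorem hypercube_adj_iff {n : ℕ} {v w : Fin n → Bool} :
    (hypercube n).Adj v w ↔ ∃ i, w = flipOn v {i} := by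
  change hammingDist v w = 1 ↔ _
  rw [hammingDist, Finset.card_eq_one]
  refine exists_congr fun i => ?_
  rw [Finset.ext_iff, funext_iff]
  refine forall_congr' fun j => ?_
  by_cases h : j = i
  · subst h
    cases hv : v j <;> cases hw : w j <;> simp [flipOn, hv, hw]
  · cases hv : v j <;> cases hw : w j <;> simp [flipOn, hv, hw, h]

open Classical in
/-- The directions of the edges of `G` at `v`. -/
noncomputable def edgeDirections {n : ℕ} (G : SimpleGraph (Fin n → Bool)) (v : Fin n → Bool) :
    Finset (Fin n) :=
  Finset.univ.filter fun i => G.Adj v (flipOn v {i})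

theorem adjPairCount_le_sum_card_edgeDirections {n : ℕ} {G : SimpleGraph (Fin n → Bool)}
    (hG : G ≤ hypercube n) : adjPairCount G ≤ ∑ v, (edgeDirections G v).card := by
  classical
  rw [adjPairCount, Nat.card_eq_fintype_card, Fintype.card_subtype, ← Finset.card_sigma]
  refine Finset.card_le_card_of_surjOn (fun p => (p.1, flipOn p.1 {p.2})) ?_
  rintro ⟨v, w⟩ h
  simp only [Finset.coe_filter, Finset.mem_univ, true_and, Set.mem_ofPred_eq] at h
  obtain ⟨i, rfl⟩ := hypercube_adj_iff.1 (hG h)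
  exact ⟨⟨v, i⟩, by simpa [edgeDirections] using h, rfl⟩

theorem mul_two_pow_le_adjPairCount_hypercube (n : ℕ) :
    n * 2 ^ n ≤ adjPairCount (hypercube n) := by
  classical
  have h : Fintype.card (Fin n × (Fin n → Bool)) = n * 2 ^ n := by simp
  rw [← h, adjPairCount, Nat.card_eq_fintype_card]
  refine Fintype.card_le_of_injective
    (fun p => ⟨(p.2, flipOn p.2 {p.1}), hypercube_adj_iff.2 ⟨p.1, rfl⟩⟩) ?_
  rintro ⟨i, v⟩ ⟨j, w⟩ h
  simp only [Subtype.mk.injEq, Prod.mk.injEq] at h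
  obtain ⟨rfl, h2⟩ := h
  have := flipOn_injective v h2
  simpa using this

/-- From this base, `v` itself is labelled `{x, u, w}`, and its neighbour in one of the three
directions is labelled by the pair of the other two. -/
theorem fullTriple_comap_flipOn {n : ℕ} {G : SimpleGraph (Fin n → Bool)} {v : Fin n → Bool}
    {x u w : Fin n} (hne : x ≠ u ∧ x ≠ w ∧ u ≠ w) (hx : x ∈ edgeDirections G v)
    (hu : u ∈ edgeDirections G v) (hw : w ∈ edgeDirections G v) :
    FullTriple (G.comap (flipOn (flipOn v {x, u, w}))) x u w := by
  obtain ⟨h1, h2, h3⟩ := hne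
  simp only [edgeDirections, Finset.mem_filter, Finset.mem_univ, true_and] at hx hu hw
  have key : ∀ (i : Fin n) (K L : Finset (Fin n)), L = insert i K → i ∉ K →
      flipOn (flipOn v L) K = flipOn v {i} := by
    rintro i K L rfl hi
    funext j
    by_cases h : j = i
    · subst h
      simp [flipOn, hi]
    · simp [flipOn, h]
  refine ⟨⟨h1, h2, h3⟩, ?_, ?_, ?_⟩
  · change G.Adj (flipOn _ _) (flipOn _ _)
    rw [flipOn_flipOn_self, key w {x, u} {x, u, w} (by ext; simp; tauto)
      (by simp [h2.symm, h3.symm])]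
    exact hw
  · change G.Adj (flipOn _ _) (flipOn _ _)
    rw [flipOn_flipOn_self, key u {x, w} {x, u, w} (by ext; simp; tauto)
      (by simp [h1.symm, h3])]
    exact hu
  · change G.Adj (flipOn _ _) (flipOn _ _)
    rw [flipOn_flipOn_self, key x {u, w} {x, u, w} rfl (by simp [h1, h2])]
    exact hx

/-- A set with `d` elements has at least `d ^ 3 - 3 d ^ 2` ordered triples of distinct elements. -/
theorem card_pow_three_le_card_distinct_triples {α : Type*} [Fintype α] [DecidableEq α]
    (D : Finset α) :
    D.card ^ 3 ≤ (Finset.univ.filter fun t : α × α × α =>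
      (t.1 ≠ t.2.1 ∧ t.1 ≠ t.2.2 ∧ t.2.1 ≠ t.2.2) ∧ t.1 ∈ D ∧ t.2.1 ∈ D ∧ t.2.2 ∈ D).card +
      3 * D.card ^ 2 := by
  set T := Finset.univ.filter fun t : α × α × α =>
      (t.1 ≠ t.2.1 ∧ t.1 ≠ t.2.2 ∧ t.2.1 ≠ t.2.2) ∧ t.1 ∈ D ∧ t.2.1 ∈ D ∧ t.2.2 ∈ D
  have hsub : D ×ˢ D ×ˢ D ⊆ ((T ∪ (D ×ˢ D).image fun p => (p.1, p.1, p.2)) ∪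
      (D ×ˢ D).image fun p => (p.1, p.2, p.1)) ∪ (D ×ˢ D).image fun p => (p.1, p.2, p.2) := by
    rintro ⟨x, u, w⟩ h
    simp only [Finset.mem_product] at h
    simp only [Finset.mem_union, Finset.mem_image, Finset.mem_product, Prod.exists, T,
      Finset.mem_filter, Finset.mem_univ, true_and, Prod.mk.injEq]
    by_cases h1 : x = u
    · subst h1
      exact Or.inl (Or.inl (Or.inr ⟨x, w, ⟨h.1, h.2.2⟩, rfl, rfl, rfl⟩))
    by_cases h2 : x = w
    · subst h2
      exact Or.inl (Or.inr ⟨x, u, ⟨h.1, h.2.1⟩, rfl, rfl, rfl⟩)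
    by_cases h3 : u = w
    · subst h3
      exact Or.inr ⟨x, u, ⟨h.1, h.2.1⟩, rfl, rfl, rfl⟩
    exact Or.inl (Or.inl (Or.inl ⟨⟨h1, h2, h3⟩, h⟩))
  have h := Finset.card_le_card hsub
  have hD : (D ×ˢ D).card = D.card ^ 2 := by rw [Finset.card_product, sq]
  rw [Finset.card_product, hD] at h
  have i1 : ∀ f : α × α → α × α × α, ((D ×ˢ D).image f).card ≤ D.card ^ 2 :=
    fun f => hD ▸ Finset.card_image_le
  have u1 := Finset.card_union_le ((T ∪ (D ×ˢ D).image fun p => (p.1, p.1, p.2)) ∪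
      (D ×ˢ D).image fun p => (p.1, p.2, p.1)) ((D ×ˢ D).image fun p => (p.1, p.2, p.2))
  have u2 := Finset.card_union_le (T ∪ (D ×ˢ D).image fun p => (p.1, p.1, p.2))
    ((D ×ˢ D).image fun p => (p.1, p.2, p.1))
  have u3 := Finset.card_union_le T ((D ×ˢ D).image fun p => (p.1, p.1, p.2))
  have j1 := i1 fun p => (p.1, p.1, p.2)
  have j2 := i1 fun p => (p.1, p.2, p.1)
  have j3 := i1 fun p => (p.1, p.2, p.2)
  have e : D.card ^ 3 = D.card * D.card ^ 2 := by ring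
  omega

open Classical in
/-- Some vertex `S` sees many full triples, in terms of the average degree `a`. -/
theorem exists_many_fullTriples {n : ℕ} (G : SimpleGraph (Fin n → Bool)) {a : ℝ} (ha : 4 ≤ a)
    (hsum : a * 2 ^ n ≤ ∑ v, ((edgeDirections G v).card : ℝ)) :
    ∃ S : Fin n → Bool, a ^ 3 / 4 ≤ ((Finset.univ.filter fun t : Fin n × Fin n × Fin n =>
      FullTriple (G.comap (flipOn S)) t.1 t.2.1 t.2.2).card : ℝ) := by
  let T : (Fin n → Bool) → Finset (Fin n × Fin n × Fin n) := fun v =>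
    Finset.univ.filter fun t => (t.1 ≠ t.2.1 ∧ t.1 ≠ t.2.2 ∧ t.2.1 ≠ t.2.2) ∧
      t.1 ∈ edgeDirections G v ∧ t.2.1 ∈ edgeDirections G v ∧ t.2.2 ∈ edgeDirections G v
  let F : (Fin n → Bool) → Finset (Fin n × Fin n × Fin n) := fun S =>
    Finset.univ.filter fun t => FullTriple (G.comap (flipOn S)) t.1 t.2.1 t.2.2
  -- Flipping is an involution, so the base and the triple determine `v`: no full triple is counted
  -- twice.
  have hTF : ∑ v, (T v).card ≤ ∑ S, (F S).card := by
    rw [← Finset.card_sigma, ← Finset.card_sigma]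
    refine Finset.card_le_card_of_injOn
      (fun p => ⟨flipOn p.1 {p.2.1, p.2.2.1, p.2.2.2}, p.2⟩) ?_ ?_
    · rintro ⟨v, t⟩ h
      simp only [T, Finset.coe_sigma, Finset.mem_univ, Set.mem_sigma_iff, Finset.mem_coe,
        Finset.mem_filter, true_and, Finset.coe_univ, Set.mem_univ] at h
      simp only [F, Finset.coe_sigma, Finset.mem_univ, Set.mem_sigma_iff, Finset.mem_coe,
        Finset.mem_filter, true_and, Finset.coe_univ, Set.mem_univ]
      exact fullTriple_comap_flipOn h.1 h.2.1 h.2.2.1 h.2.2.2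
    · rintro ⟨v, t⟩ _ ⟨v', t'⟩ _ h
      simp only [Sigma.mk.injEq, heq_eq_eq] at h
      obtain ⟨h1, rfl⟩ := h
      have := congrArg (fun z => flipOn z {t.1, t.2.1, t.2.2}) h1
      simp only [flipOn_flipOn_self] at this
      rw [this]
  -- The tangent of `d ^ 3 - 3 * d ^ 2` at `d = a`, with slope `3 * a ^ 2 - 6 * a`. Its value `a ^ 3
  -- - 3 * a ^ 2` there is at least `a ^ 3 / 4` because `a ≥ 4`. When summed over `v`, the linear
  -- term is nonnegative.
  have hT : ∀ v, a ^ 3 / 4 + (3 * a ^ 2 - 6 * a) * ((edgeDirections G v).card - a) ≤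
      ((T v).card : ℝ) := by
    intro v
    have h1 : ((edgeDirections G v).card : ℝ) ^ 3 ≤ (T v).card +
        3 * ((edgeDirections G v).card : ℝ) ^ 2 := by
      exact_mod_cast card_pow_three_le_card_distinct_triples (edgeDirections G v)
    have h2 : (0 : ℝ) ≤ (edgeDirections G v).card := Nat.cast_nonneg _
    set d : ℝ := ((edgeDirections G v).card : ℝ)
    have h3 : 0 ≤ (d - a) ^ 2 * (d + 2 * a - 3) :=
      mul_nonneg (sq_nonneg _) (by linarith)
    have h4 : 0 ≤ a ^ 2 * (a - 4) := mul_nonneg (sq_nonneg _) (by linarith)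
    nlinarith
  by_contra! hcon
  have h1 : ∑ S, ((F S).card : ℝ) < ∑ _S : Fin n → Bool, a ^ 3 / 4 :=
    Finset.sum_lt_sum_of_nonempty Finset.univ_nonempty fun S _ => hcon S
  have h2 := Finset.sum_le_sum fun v (_ : v ∈ (Finset.univ : Finset (Fin n → Bool))) => hT v
  rw [Finset.sum_add_distrib, ← Finset.mul_sum, Finset.sum_sub_distrib] at h2
  have h3 : (∑ v, ((T v).card : ℝ)) ≤ ∑ S, ((F S).card : ℝ) := by exact_mod_cast hTF
  have h4 : ∑ _v : Fin n → Bool, a = a * 2 ^ n := by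
    simp [mul_comm]
  rw [h4] at h2
  have h5 : 0 ≤ (3 * a ^ 2 - 6 * a) * (∑ v, ((edgeDirections G v).card : ℝ) - a * 2 ^ n) :=
    mul_nonneg (by nlinarith) (by linarith)
  linarith

open Classical in
/-- If the sum of the row sizes of a relation is large, two rows have a large intersection. -/
theorem exists_pair_large_intersection {α β : Type*} [Fintype α] [Fintype β] (r : α → β → Prop)
    (M : ℕ)
    (h : Fintype.card β * (Fintype.card α ^ 2 * M + ∑ x, (Finset.univ.filter (r x)).card) <
      (∑ x, (Finset.univ.filter (r x)).card) ^ 2) :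
    ∃ x x', x ≠ x' ∧ M < (Finset.univ.filter fun b => r x b ∧ r x' b).card := by
  by_contra! hcon
  have h1 : ∑ q : α × α, (Finset.univ.filter fun b => r q.1 b ∧ r q.2 b).card =
      ∑ b, (Finset.univ.filter fun x => r x b).card ^ 2 := by
    have := Finset.sum_card_bipartiteAbove_eq_sum_card_bipartiteBelow
      (s := (Finset.univ : Finset (α × α))) (t := (Finset.univ : Finset β))
      (fun q b => r q.1 b ∧ r q.2 b)
    refine this.trans (Finset.sum_congr rfl fun b _ => ?_)
    rw [sq, ← Finset.card_product]
    congr 1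
    ext q
    simp [Finset.mem_bipartiteBelow]
  have h2 : ∑ x, (Finset.univ.filter (r x)).card =
      ∑ b, (Finset.univ.filter fun x => r x b).card :=
    Finset.sum_card_bipartiteAbove_eq_sum_card_bipartiteBelow r
  have h3 := sq_sum_le_card_mul_sum_sq (s := (Finset.univ : Finset β))
    (f := fun b => (Finset.univ.filter fun x => r x b).card)
  rw [← h2, ← h1, Finset.card_univ] at h3
  -- The diagonal pairs contribute the row sizes themselves, which accounts for the second summand
  -- in the hypothesis.
  have h4 : ∑ q : α × α, (Finset.univ.filter fun b => r q.1 b ∧ r q.2 b).card ≤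
      ∑ q : α × α, (M + if q.1 = q.2 then (Finset.univ.filter (r q.1)).card else 0) := by
    refine Finset.sum_le_sum fun q _ => ?_
    split_ifs with hq
    · rw [← hq]
      simp
    · exact hcon _ _ hq
  have h5 : ∑ q : α × α, (M + if q.1 = q.2 then (Finset.univ.filter (r q.1)).card else 0) =
      Fintype.card α ^ 2 * M + ∑ x, (Finset.univ.filter (r x)).card := by
    rw [Finset.sum_add_distrib, Finset.sum_const, Finset.card_univ, Fintype.card_prod, smul_eq_mul,
      ← sq, Fintype.sum_prod_type]
    congr 1
    refine Finset.sum_congr rfl fun x _ => ?_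
    simp
  rw [h5] at h4
  exact absurd (h3.trans (Nat.mul_le_mul_left _ h4)) (not_le.2 h)

/-! ### Edge density of subgraphs without a cycle of length 2k -/

open SimpleGraph in
/-- A subgraph of the hypercube with large average degree `a` contains the cycles of length `4 m`
and `4 m + 6`. -/
theorem cycles_isContained_of_average_degree {n m M : ℕ} (hm : 2 ≤ m)
    (hM : n ^ 3 * (m + (2 * m) ^ 2) ≤ M ^ 2) (G : SimpleGraph (Fin n → Bool)) {a : ℝ} (ha : 4 ≤ a)
    (haM : (n : ℝ) ^ 2 * ((n : ℝ) ^ 2 * M + a ^ 3 / 4) < (a ^ 3 / 4) ^ 2)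
    (hsum : a * 2 ^ n ≤ ∑ v, ((edgeDirections G v).card : ℝ)) :
    cycleGraph (4 * m) ⊑ G ∧ cycleGraph (4 * m + 6) ⊑ G := by
  classical
  obtain ⟨S, hS⟩ := exists_many_fullTriples G ha hsum
  set H := G.comap (flipOn S) with hH
  have hHG : H ⊑ G := ⟨⟨⟨flipOn S, fun h => h⟩, flipOn_injective S⟩⟩
  obtain ⟨x, x', hxx', hlt⟩ := exists_pair_large_intersection
    (fun (x : Fin n) (p : Fin n × Fin n) => FullTriple H x p.1 p.2) M (by
      have e : (Finset.univ.filter fun t : Fin n × Fin n × Fin n =>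
          FullTriple H t.1 t.2.1 t.2.2).card =
          ∑ x, (Finset.univ.filter fun p : Fin n × Fin n => FullTriple H x p.1 p.2).card := by
        rw [← Finset.card_sigma]
        refine Finset.card_bij (fun t _ => ⟨t.1, t.2⟩) ?_ ?_ ?_
        · intro t ht
          simpa using ht
        · rintro ⟨x, p⟩ _ ⟨x', p'⟩ _ h
          simpa using h
        · rintro ⟨x, p⟩ h
          exact ⟨(x, p), by simpa using h, rfl⟩
      rw [← e]
      set f := (Finset.univ.filter fun t : Fin n × Fin n × Fin n =>
          FullTriple H t.1 t.2.1 t.2.2).card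
      rw [Fintype.card_prod, Fintype.card_fin, ← sq]
      have hx0 : 0 < a ^ 3 / 4 := by positivity
      -- Beyond `a ^ 3 / 4` the function `t ^ 2 - n ^ 2 * t` is therefore increasing, so `haM`
      -- passes from `a ^ 3 / 4` to the true count `f`.
      have hn : (n : ℝ) ^ 2 < a ^ 3 / 4 := by
        have : (0 : ℝ) ≤ (n : ℝ) ^ 2 * ((n : ℝ) ^ 2 * M) := by positivity
        by_contra! hcon
        nlinarith
      have : (n : ℝ) ^ 2 * ((n : ℝ) ^ 2 * M + f) < (f : ℝ) ^ 2 := by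
        nlinarith [mul_nonneg (sub_nonneg.2 hS) (show 0 ≤ a ^ 3 / 4 + f - (n : ℝ) ^ 2 by linarith)]
      exact_mod_cast this)
  let B : SimpleGraph (Fin n) :=
    { Adj := fun u w => FullTriple H x u w ∧ FullTriple H x' u w
      symm := ⟨fun _ _ h => ⟨h.1.swap, h.2.swap⟩⟩
      loopless := ⟨fun _ h => h.1.1.2.2 rfl⟩ }
  have hdeg : (Finset.univ.filter fun p : Fin n × Fin n =>
      FullTriple H x p.1 p.2 ∧ FullTriple H x' p.1 p.2).card = ∑ z, B.degree z := by
    have : ∀ z, B.degree z = (B.neighborFinset z).card := fun z => rfl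
    simp only [this]
    rw [← Finset.card_sigma]
    refine Finset.card_bij (fun t _ => ⟨t.1, t.2⟩) ?_ ?_ ?_
    · intro t ht
      simpa [B] using ht
    · rintro ⟨x, p⟩ _ ⟨x', p'⟩ _ h
      simpa using h
    · rintro ⟨u, w⟩ h
      exact ⟨(u, w), by simpa [B] using h, rfl⟩
  rw [hdeg] at hlt
  obtain ⟨c, y, hper, hinj, hc, hy, hyc⟩ := exists_even_cycle_with_pendant B m hm (by
    rw [Fintype.card_fin]
    exact hM.trans_lt (Nat.pow_lt_pow_left hlt two_ne_zero))
  exact ⟨(cycleGraph_four_mul_isContained hm hper hinj fun i hi => (hc i hi).1).trans hHG,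
    (cycleGraph_four_mul_add_six_isContained hxx' hm hper hinj hyc (fun i hi => (hc i hi).1)
      (fun i hi => (hc i hi).2) hy.1 hy.2).trans hHG⟩

/-- Subgraphs of the hypercube without a cycle of length `2 k`, where `k ≥ 4` and `k ≠ 5`, have
density `O(n ^ (-1/16))`. -/
theorem exists_adjPairCount_le (k : ℕ) (hk : 4 ≤ k) (hk5 : k ≠ 5) :
    ∃ c : ℝ, 0 < c ∧ ∀ n : ℕ, 0 < n → ∀ G : SimpleGraph (Fin n → Bool), G ≤ hypercube n →
      (SimpleGraph.cycleGraph (2 * k)).Free G →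
      (adjPairCount G : ℝ) ≤ c * (n : ℝ) ^ (-(1 / 16) : ℝ) * (n * 2 ^ n) := by
  -- Even `k` is `2 * m` and odd `k` is `2 * m + 3`. Here `k = 5` would give `m = 1`, for which
  -- there is no link cycle.
  obtain ⟨m, hm, hmk⟩ : ∃ m, 2 ≤ m ∧ (2 * k = 4 * m ∨ 2 * k = 4 * m + 6) := by
    obtain ⟨m, rfl | rfl⟩ := Nat.even_or_odd' k
    · exact ⟨m, by omega, by omega⟩
    · exact ⟨m - 1, by omega, by omega⟩
  -- The summand 4 ensures average degree at least 4; `192 * m = 32 * (6 * m)` absorbs the bound `6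
  -- * m * β ^ 24` for `M` in `t1`.
  refine ⟨4 + 192 * m, by positivity, fun n hn G hG hfree => ?_⟩
  set c : ℝ := 4 + 192 * m with hc
  have hn1 : (1 : ℝ) ≤ n := by exact_mod_cast hn
  have hn0 : (0 : ℝ) < n := by linarith
  -- All quantities become powers of `β`: the average degree is `c * β ^ 15` and `M` has order `n ^
  -- (3 / 2) = β ^ 24`. The decisive comparison is `n ^ 4 * M`, of order `β ^ 88`, against the sixth
  -- power of the degree, of order `β ^ 90`.
  set β : ℝ := (n : ℝ) ^ (1 / 16 : ℝ) with hβ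
  have hβ1 : 1 ≤ β := Real.one_le_rpow hn1 (by norm_num)
  have hβ0 : 0 < β := by linarith
  have hβn : β ^ 16 = n := by
    rw [hβ, ← Real.rpow_natCast, ← Real.rpow_mul hn0.le]
    norm_num
  have hβi : (n : ℝ) ^ (-(1 / 16) : ℝ) = β⁻¹ := Real.rpow_neg hn0.le _
  have hm2 : (2 : ℝ) ≤ m := by exact_mod_cast hm
  rw [hβi]
  have hgoal : c * β⁻¹ * (n * 2 ^ n) = c * β ^ 15 * 2 ^ n := by
    rw [← hβn]
    field_simp
  rw [hgoal]
  by_contra! hcon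
  have hsum : c * β ^ 15 * 2 ^ n ≤ ∑ v, ((edgeDirections G v).card : ℝ) := by
    refine hcon.le.trans ?_
    exact_mod_cast adjPairCount_le_sum_card_edgeDirections hG
  have hβp : ∀ j : ℕ, 1 ≤ β ^ j := fun j => one_le_pow₀ hβ1
  have hM : n ^ 3 * (m + (2 * m) ^ 2) ≤ ⌈3 * m * β ^ 24⌉₊ ^ 2 := by
    have h1 : (3 * m * β ^ 24) ^ 2 ≤ (⌈3 * m * β ^ 24⌉₊ : ℝ) ^ 2 := by
      gcongr
      exact Nat.le_ceil _
    have h2 : (n : ℝ) ^ 3 * (m + (2 * m) ^ 2) ≤ (3 * m * β ^ 24) ^ 2 := by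
      rw [← hβn, show (3 * m * β ^ 24) ^ 2 = (β ^ 16) ^ 3 * (9 * (m : ℝ) ^ 2) by ring]
      gcongr
      nlinarith
    exact_mod_cast h2.trans h1
  have hMle : (⌈3 * m * β ^ 24⌉₊ : ℝ) ≤ 6 * m * β ^ 24 := by
    have h1 := (Nat.ceil_lt_add_one (show 0 ≤ 3 * m * β ^ 24 by positivity)).le
    have h2 : 1 ≤ 3 * m * β ^ 24 := by nlinarith [hβp 24]
    linarith
  have hc4 : 4 ≤ c := by rw [hc]; linarith
  have hcm : 192 * m < c := by rw [hc]; linarith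
  have ha : 4 ≤ c * β ^ 15 := by nlinarith [hβp 15]
  have haM : (n : ℝ) ^ 2 * ((n : ℝ) ^ 2 * ⌈3 * m * β ^ 24⌉₊ + (c * β ^ 15) ^ 3 / 4) <
      ((c * β ^ 15) ^ 3 / 4) ^ 2 := by
    have hc3 : 64 ≤ c ^ 3 := by
      calc (64 : ℝ) = 4 ^ 3 := by norm_num
        _ ≤ c ^ 3 := by gcongr
    have hc6 : 192 * m < c ^ 6 := by
      refine hcm.trans_le ?_
      exact le_self_pow₀ (by linarith) (by norm_num)
    have e1 : β ^ 32 ≤ β ^ 45 := pow_le_pow_right₀ hβ1 (by norm_num)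
    have e2 : β ^ 88 ≤ β ^ 90 := pow_le_pow_right₀ hβ1 (by norm_num)
    have t1 : (n : ℝ) ^ 2 * ((n : ℝ) ^ 2 * ⌈3 * m * β ^ 24⌉₊) < c ^ 6 * β ^ 90 / 32 := by
      calc (n : ℝ) ^ 2 * ((n : ℝ) ^ 2 * ⌈3 * m * β ^ 24⌉₊)
          ≤ (n : ℝ) ^ 2 * ((n : ℝ) ^ 2 * (6 * m * β ^ 24)) := by gcongr
        _ = 192 * m * β ^ 88 / 32 := by rw [← hβn]; ring
        _ < c ^ 6 * β ^ 88 / 32 := by gcongr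
        _ ≤ c ^ 6 * β ^ 90 / 32 := by gcongr
    have t2 : (n : ℝ) ^ 2 * ((c * β ^ 15) ^ 3 / 4) ≤ c ^ 6 * β ^ 90 / 32 := by
      have : (n : ℝ) ^ 2 ≤ c ^ 3 * β ^ 45 / 8 := by
        rw [← hβn]
        nlinarith [hβp 45]
      calc (n : ℝ) ^ 2 * ((c * β ^ 15) ^ 3 / 4)
          ≤ c ^ 3 * β ^ 45 / 8 * ((c * β ^ 15) ^ 3 / 4) := by gcongr
        _ = _ := by ring
    have t3 : ((c * β ^ 15) ^ 3 / 4) ^ 2 = c ^ 6 * β ^ 90 / 32 + c ^ 6 * β ^ 90 / 32 := by ring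
    rw [t3, mul_add]
    exact add_lt_add_of_lt_of_le t1 t2
  obtain ⟨h1, h2⟩ := cycles_isContained_of_average_degree hm hM G ha haM hsum
  rcases hmk with h | h
  · exact hfree (h ▸ h1)
  · exact hfree (h ▸ h2)

/-! ### Arc-transitivity of the hypercube and the upper bound -/

/-- The automorphism of the hypercube that exchanges two positions and moves `u` to `u'`. -/
def cubeSwap {n : ℕ} (i j : Fin n) (u u' : Fin n → Bool) (x : Fin n → Bool) : Fin n → Bool :=
  fun t => xor (xor (x (Equiv.swap i j t)) (u (Equiv.swap i j t))) (u' t)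

theorem cubeSwap_cubeSwap {n : ℕ} (i j : Fin n) (u u' x : Fin n → Bool) :
    cubeSwap i j u' u (cubeSwap i j u u' x) = x := by
  funext t
  simp [cubeSwap]

/-- Directions are permuted by the transposition, whatever the translation; this gives both
adjacency preservation and control over the image of an arc. -/
theorem cubeSwap_flipOn {n : ℕ} (i j : Fin n) (u u' x : Fin n → Bool) (a : Fin n) :
    cubeSwap i j u u' (flipOn x {a}) = flipOn (cubeSwap i j u u' x) {Equiv.swap i j a} := by
  funext t
  have : Equiv.swap i j t = a ↔ t = Equiv.swap i j a := by
    rw [Equiv.swap_apply_eq_iff]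
  simp only [cubeSwap, flipOn, Finset.mem_singleton, this]
  cases x (Equiv.swap i j t) <;> cases u (Equiv.swap i j t) <;> cases u' t <;> simp

theorem hypercube_arc_transitive {n : ℕ} (u v u' v' : Fin n → Bool) (h : (hypercube n).Adj u v)
    (h' : (hypercube n).Adj u' v') : ∃ φ : hypercube n ≃g hypercube n, φ u = u' ∧ φ v = v' := by
  obtain ⟨i, rfl⟩ := hypercube_adj_iff.1 h
  obtain ⟨j, rfl⟩ := hypercube_adj_iff.1 h'
  have hom : ∀ w w' x y, (hypercube n).Adj x y →
      (hypercube n).Adj (cubeSwap i j w w' x) (cubeSwap i j w w' y) := by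
    intro w w' x y hxy
    obtain ⟨a, rfl⟩ := hypercube_adj_iff.1 hxy
    rw [cubeSwap_flipOn]
    exact hypercube_adj_iff.2 ⟨_, rfl⟩
  have hu : cubeSwap i j u u' u = u' := by
    funext t
    simp [cubeSwap]
  refine ⟨⟨⟨cubeSwap i j u u', cubeSwap i j u' u, cubeSwap_cubeSwap i j u u',
    cubeSwap_cubeSwap i j u' u⟩, ?_⟩, hu, ?_⟩
  · intro x y
    refine ⟨fun hxy => ?_, hom u u' x y⟩
    have := hom u' u _ _ hxy
    simpa only [Equiv.coe_fn_mk, cubeSwap_cubeSwap] using this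
  · change cubeSwap i j u u' (flipOn u {i}) = _
    rw [cubeSwap_flipOn, hu, Equiv.swap_apply_left]

/-- The generalized Turán density of the cycles of length `2 k`, `k ≥ 4`, `k ≠ 5`, in the
hypercube tends to zero, for all graphs with at least one edge. -/
theorem exists_genTuranDensity_le (k : ℕ) (hk : 4 ≤ k) (hk5 : k ≠ 5) :
    ∃ c : ℝ, 0 < c ∧ ∀ n : ℕ, 0 < n → ∀ {W : Type} [Fintype W] (T : SimpleGraph W) (a b : W),
      T.Adj a b →
      genTuranDensity (hypercube n) T (SimpleGraph.cycleGraph (2 * k)) ≤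
        c * (n : ℝ) ^ (-(1 / 16) : ℝ) := by
  obtain ⟨c, hc, h⟩ := exists_adjPairCount_le k hk hk5
  refine ⟨c, hc, fun n hn W _ T a b hab => ?_⟩
  have hne : {m : ℕ | ∃ G' : SimpleGraph (Fin n → Bool), G' ≤ hypercube n ∧
      (SimpleGraph.cycleGraph (2 * k)).Free G' ∧ m = G'.copyCount T}.Nonempty := by
    refine ⟨_, ⊥, bot_le, SimpleGraph.free_bot ?_, rfl⟩
    intro h0
    have h1 : (SimpleGraph.cycleGraph (2 * k)).Adj ⟨1, by omega⟩ ⟨0, by omega⟩ := by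
      rw [SimpleGraph.cycleGraph_adj']
      left
      rw [Fin.sub_val_of_le (by simp [Fin.le_def])]
      rfl
    rw [h0] at h1
    exact h1
  obtain ⟨G, hG, hfree, hcount⟩ := Nat.sSup_mem hne (genEx_set_finite _ _ _).bddAbove
  have hex : genEx (hypercube n) T (SimpleGraph.cycleGraph (2 * k)) = G.copyCount T := hcount
  rw [genTuranDensity, hex]
  have hn0 : (0 : ℝ) < n := by exact_mod_cast hn
  -- No positivity of the denominator is needed: if there are no copies at all, the quotient is 0.
  refine div_le_of_le_mul₀ (Nat.cast_nonneg _) (by positivity) ?_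
  have h1 : ((G.copyCount T : ℝ)) * adjPairCount (hypercube n) ≤
      (hypercube n).copyCount T * adjPairCount G := by
    exact_mod_cast copyCount_mul_adjPairCount_le hG hypercube_arc_transitive hab
  have h2 : (n * 2 ^ n : ℝ) ≤ adjPairCount (hypercube n) := by
    exact_mod_cast mul_two_pow_le_adjPairCount_hypercube n
  have h3 := h n hn G hG hfree
  have hpos : (0 : ℝ) < n * 2 ^ n := by positivity
  refine le_of_mul_le_mul_right ?_ hpos
  calc (G.copyCount T : ℝ) * (n * 2 ^ n)
      ≤ G.copyCount T * adjPairCount (hypercube n) := by gcongr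
    _ ≤ (hypercube n).copyCount T * adjPairCount G := h1
    _ ≤ (hypercube n).copyCount T * (c * (n : ℝ) ^ (-(1 / 16) : ℝ) * (n * 2 ^ n)) := by gcongr
    _ = _ := by ring

/-! ### Even cycles in the hypercube -/

theorem hypercube_adj_cons {q : ℕ} (b : Bool) {x y : Fin q → Bool} (h : (hypercube q).Adj x y) :
    (hypercube (q + 1)).Adj (Fin.cons b x : Fin (q + 1) → Bool) (Fin.cons b y) := by
  obtain ⟨i, rfl⟩ := hypercube_adj_iff.1 h
  refine hypercube_adj_iff.2 ⟨i.succ, ?_⟩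
  funext j
  refine Fin.cases ?_ (fun j => ?_) j
  · simp [flipOn, (Fin.succ_ne_zero i).symm]
  · simp [flipOn]

theorem hypercube_adj_cons_cons {q : ℕ} {b b' : Bool} (hb : b ≠ b') (x : Fin q → Bool) :
    (hypercube (q + 1)).Adj (Fin.cons b x : Fin (q + 1) → Bool) (Fin.cons b' x) := by
  refine hypercube_adj_iff.2 ⟨0, ?_⟩
  funext j
  refine Fin.cases ?_ (fun j => ?_) j
  · cases b <;> cases b' <;> simp_all [flipOn]
  · simp [flipOn]

/-- The sequence that runs through `g 0, …, g (l - 1)` in one half of the cube and back in the other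
half. -/
def ladderSeq {q : ℕ} (g : ℕ → Fin q → Bool) (l j : ℕ) : Fin (q + 1) → Bool :=
  if j < l then Fin.cons false (g j) else Fin.cons true (g (2 * l - 1 - j))

theorem ladderSeq_injective {q : ℕ} {g : ℕ → Fin q → Bool} {l : ℕ}
    (hg : ∀ i < l, ∀ j < l, g i = g j → i = j) :
    ∀ i < 2 * l, ∀ j < 2 * l, ladderSeq g l i = ladderSeq g l j → i = j := by
  intro i hi j hj h
  unfold ladderSeq at h
  split_ifs at h with h1 h2 h2
  · exact hg _ h1 _ h2 (Fin.cons_inj.1 h).2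
  · simpa using (Fin.cons_inj.1 h).1
  · simpa using (Fin.cons_inj.1 h).1
  · have := hg _ (by omega) _ (by omega) (Fin.cons_inj.1 h).2
    omega

theorem ladderSeq_adj {q : ℕ} {g : ℕ → Fin q → Bool} {l : ℕ}
    (hg : ∀ i, i + 1 < l → (hypercube q).Adj (g i) (g (i + 1))) :
    ∀ i, i + 1 < 2 * l → (hypercube (q + 1)).Adj (ladderSeq g l i) (ladderSeq g l (i + 1)) := by
  intro i hi
  unfold ladderSeq
  rcases lt_trichotomy (i + 1) l with h | h | h
  · rw [if_pos (by omega), if_pos h]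
    exact hypercube_adj_cons _ (hg i h)
  · rw [if_pos (by omega), if_neg (by omega), show 2 * l - 1 - (i + 1) = i by omega]
    exact hypercube_adj_cons_cons (by simp) _
  · rw [if_neg (by omega), if_neg (by omega),
      show 2 * l - 1 - i = 2 * l - 1 - (i + 1) + 1 by omega]
    exact (hypercube_adj_cons _ (hg _ (by omega))).symm

/-- Gray code: the hypercube has a Hamiltonian path. -/
theorem exists_gray_code (q : ℕ) : ∃ g : ℕ → Fin q → Bool,
    (∀ i < 2 ^ q, ∀ j < 2 ^ q, g i = g j → i = j) ∧
    ∀ i, i + 1 < 2 ^ q → (hypercube q).Adj (g i) (g (i + 1)) := by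
  induction q with
  | zero => exact ⟨fun _ => Fin.elim0, by intro i hi j hj _; simp at hi hj; omega,
      by intro i hi; simp at hi⟩
  | succ q ih =>
    obtain ⟨g, h1, h2⟩ := ih
    refine ⟨ladderSeq g (2 ^ q), ?_, ?_⟩
    · rw [pow_succ, mul_comm]
      exact ladderSeq_injective h1
    · rw [pow_succ, mul_comm]
      exact ladderSeq_adj h2

open SimpleGraph in
/-- The hypercube contains all even cycles whose length is at most the number of vertices. -/
theorem cycleGraph_isContained_hypercube {l q : ℕ} (hl : 2 ≤ l) (h : 2 * l ≤ 2 ^ q) :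
    cycleGraph (2 * l) ⊑ hypercube q := by
  cases q with
  | zero =>
    rw [pow_zero] at h
    omega
  | succ q =>
    rw [pow_succ, mul_comm] at h
    obtain ⟨g, h1, h2⟩ := exists_gray_code q
    obtain ⟨F, -⟩ := exists_copy_cycleGraph (H := hypercube (q + 1)) (N := 2 * l) (ladderSeq g l)
      (ladderSeq_injective fun i hi j hj => h1 i (by omega) j (by omega))
      (ladderSeq_adj fun i hi => h2 i (by omega)) (by
        unfold ladderSeq
        rw [if_neg (by omega), if_pos (by omega), show 2 * l - 1 - (2 * l - 1) = 0 by omega]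
        exact hypercube_adj_cons_cons (by simp) _)
    exact ⟨F⟩

/-- Some cycle of length `2 l` in the hypercube `Q_l` uses all positions. -/
theorem starCycleCount_pos {l : ℕ} (hl : 2 ≤ l) : 0 < starCycleCount l l := by
  -- Switch the positions `0, …, l - 1` on one after the other, then off in the same order.
  let f : ℕ → Fin l → Bool := fun j i => decide (i.val < j ∧ j ≤ i.val + l)
  have hadj : ∀ j, j + 1 < 2 * l → (hypercube l).Adj (f j) (f (j + 1)) := by
    intro j hj
    rcases lt_or_ge j l with h | h
    · refine hypercube_adj_iff.2 ⟨⟨j, h⟩, ?_⟩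
      funext i
      have hi := i.isLt
      rw [Bool.eq_iff_iff]
      simp only [f, flipOn, Finset.mem_singleton, Fin.ext_iff, bne_iff_ne, ne_eq,
        decide_eq_decide, decide_eq_true_eq]
      omega
    · refine hypercube_adj_iff.2 ⟨⟨j - l, by omega⟩, ?_⟩
      funext i
      have hi := i.isLt
      rw [Bool.eq_iff_iff]
      simp only [f, flipOn, Finset.mem_singleton, Fin.ext_iff, bne_iff_ne, ne_eq,
        decide_eq_decide, decide_eq_true_eq]
      omega
  have hlast : (hypercube l).Adj (f (2 * l - 1)) (f 0) := by
    refine hypercube_adj_iff.2 ⟨⟨l - 1, by omega⟩, ?_⟩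
    funext i
    have hi := i.isLt
    rw [Bool.eq_iff_iff]
    simp only [f, flipOn, Finset.mem_singleton, Fin.ext_iff, bne_iff_ne, ne_eq,
      decide_eq_decide, decide_eq_true_eq]
    omega
  have hinj : ∀ i < 2 * l, ∀ j < 2 * l, f i = f j → i = j := by
    have key : ∀ i < 2 * l, ∀ j < 2 * l, i < j → f i ≠ f j := by
      intro i hi j hj hij h
      have h2 : ∀ t : Fin l, (t.val < i ∧ i ≤ t.val + l) ↔ (t.val < j ∧ j ≤ t.val + l) := by
        intro t
        exact decide_eq_decide.1 (congrFun h t)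
      rcases lt_or_ge i l with h3 | h3
      · rcases lt_or_ge j l with h4 | h4
        · have := h2 ⟨i, h3⟩
          simp only at this
          omega
        · have h5 := h2 ⟨i, h3⟩
          have h6 := h2 ⟨l - 1, by omega⟩
          simp only at h5 h6
          omega
      · have := h2 ⟨i - l, by omega⟩
        simp only at this
        omega
    intro i hi j hj h
    rcases lt_trichotomy i j with h1 | h1 | h1
    · exact absurd h (key i hi j hj h1)
    · exact h1
    · exact absurd h.symm (key j hj i hi h1)
  obtain ⟨F, hF⟩ := exists_copy_cycleGraph (H := hypercube l) (N := 2 * l) f hinj hadj hlast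
  rw [starCycleCount, Set.ncard_pos (Set.toFinite _)]
  refine ⟨F.toSubgraph, ⟨F.isoToSubgraph⟩, fun i => ?_⟩
  have hi := i.isLt
  refine ⟨f i, f (i + 1), ?_, ?_⟩
  · rw [SimpleGraph.Subgraph.map_adj]
    refine ⟨⟨i, by omega⟩, ⟨i + 1, by omega⟩, ?_, hF _, hF _⟩
    rw [SimpleGraph.Subgraph.top_adj, SimpleGraph.cycleGraph_adj']
    right
    rw [Fin.sub_val_of_le (by simp [Fin.le_def])]
    simp
  · simp only [f, ne_eq, decide_eq_decide]
    omega

/-! ### Subcubes and the parallel copies for the lower bound -/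

section Subcube

variable {s n : ℕ} (e : Fin s ↪ Fin n) (b : Fin n → Bool)

theorem extend_comp_embedding (z : Fin s → Bool) : Function.extend e z b ∘ e = z :=
  funext fun _ => e.injective.extend_apply _ _ _

theorem extend_embedding_injective : Function.Injective fun z => Function.extend e z b := by
  intro z z' h
  rw [← extend_comp_embedding e b z, ← extend_comp_embedding e b z']
  exact congrArg (· ∘ e) h

/-- Subcubes of the hypercube are spanned by a set of free positions and a base vertex. -/
theorem hypercube_adj_extend_iff {z z' : Fin s → Bool} :
    (hypercube n).Adj (Function.extend e z b) (Function.extend e z' b) ↔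
      (hypercube s).Adj z z' := by
  rw [hypercube_adj_iff, hypercube_adj_iff]
  have hflip : ∀ t, Function.extend e (flipOn z {t}) b =
      flipOn (Function.extend e z b) {e t} := by
    intro t
    funext i
    by_cases hi : ∃ a, e a = i
    · obtain ⟨a, rfl⟩ := hi
      simp [flipOn, e.injective.extend_apply]
    · have h1 : i ≠ e t := fun h => hi ⟨t, h.symm⟩
      simp [flipOn, Function.extend_apply' _ _ _ hi, h1]
  constructor
  · rintro ⟨i, hi⟩
    by_cases hr : ∃ a, e a = i
    · obtain ⟨t, rfl⟩ := hr
      refine ⟨t, ?_⟩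
      rw [← hflip] at hi
      exact extend_embedding_injective e b hi
    · have := congrFun hi i
      simp [flipOn, Function.extend_apply' _ _ _ hr] at this
  · rintro ⟨t, rfl⟩
    exact ⟨e t, hflip t⟩

/-- The embedding of a subcube. -/
noncomputable def subcubeHom : hypercube s →g hypercube n where
  toFun z := Function.extend e z b
  map_rel' h := (hypercube_adj_extend_iff e b).2 h

theorem subcubeHom_apply (z : Fin s → Bool) : subcubeHom e b z = Function.extend e z b := rfl

theorem extend_comp_eq {x : Fin n → Bool} (hx : ∀ i, (¬∃ t, e t = i) → x i = b i) :
    Function.extend e (x ∘ e) b = x := by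
  funext i
  by_cases hi : ∃ a, e a = i
  · obtain ⟨a, rfl⟩ := hi
    simp [e.injective.extend_apply]
  · rw [Function.extend_apply' _ _ _ hi, hx i hi]

end Subcube

theorem copyCount_eq_natCard {V W : Type*} [Fintype V] (G : SimpleGraph V) (T : SimpleGraph W) :
    G.copyCount T = Nat.card {C : G.Subgraph // Nonempty (T ≃g C.coe)} := by
  classical
  rw [SimpleGraph.copyCount, Nat.card_eq_fintype_card, Fintype.card_subtype]

/-- The graph that has a copy of `T` in each of the parallel subcubes with free positions `e`. -/
def parallelCopies {s n : ℕ} (e : Fin s ↪ Fin n) {W : Type*} {T : SimpleGraph W}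
    (f : SimpleGraph.Copy T (hypercube s)) : SimpleGraph (Fin n → Bool) where
  Adj x y := (∀ i, (¬∃ t, e t = i) → x i = y i) ∧ ∃ p p', T.Adj p p' ∧ f p = x ∘ e ∧ f p' = y ∘ e
  symm := ⟨fun _ _ ⟨h, p, p', hp, h1, h2⟩ => ⟨fun i hi => (h i hi).symm, p', p, hp.symm, h2, h1⟩⟩
  loopless := ⟨fun _ ⟨_, _, _, hp, h1, h2⟩ => hp.ne (f.injective (h1.trans h2.symm))⟩

section ParallelCopies

variable {s n : ℕ} (e : Fin s ↪ Fin n) {W : Type*} {T : SimpleGraph W}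
  (f : SimpleGraph.Copy T (hypercube s))

theorem parallelCopies_le : parallelCopies e f ≤ hypercube n := by
  rintro x y ⟨h, p, p', hp, h1, h2⟩
  rw [← extend_comp_eq e x (fun i _ => rfl), ← extend_comp_eq (x := y) e x
    (fun i hi => (h i hi).symm), hypercube_adj_extend_iff, ← h1, ← h2]
  exact f.toHom.map_adj hp

open SimpleGraph in
/-- A connected graph with an edge at each vertex that is contained in the union of parallel copies
of `T` is contained in `T`. -/
theorem isContained_of_isContained_parallelCopies {U : Type*} {H : SimpleGraph U}
    (hH : H.Preconnected) (hH' : ∀ v, ∃ w, H.Adj v w) (h : H ⊑ parallelCopies e f) : H ⊑ T := by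
  obtain ⟨g⟩ := h
  have hg : ∀ v, ∃ p, f p = g v ∘ e := by
    intro v
    obtain ⟨w, hw⟩ := hH' v
    obtain ⟨-, p, -, -, hp, -⟩ := g.toHom.map_adj hw
    exact ⟨p, hp⟩
  choose k hk using hg
  -- Edges of the union never change a fixed position, so a connected `H` stays in one subcube,
  -- where the restriction to the free positions is injective.
  have hbase : ∀ v w, ∀ i, (¬∃ t, e t = i) → g v i = g w i := by
    intro v w
    obtain ⟨p⟩ := hH v w
    induction p with
    | nil => exact fun _ _ => rfl
    | cons hvw _ ih => exact fun i hi => ((g.toHom.map_adj hvw).1 i hi).trans (ih i hi)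
  refine ⟨⟨⟨k, ?_⟩, ?_⟩⟩
  · intro v w hvw
    obtain ⟨-, p, p', hp, h1, h2⟩ := g.toHom.map_adj hvw
    have e1 : p = k v := f.injective (h1.trans (hk v).symm)
    have e2 : p' = k w := f.injective (h2.trans (hk w).symm)
    rwa [← e1, ← e2]
  · intro v w hvw
    apply g.injective
    change g v = g w
    have hvw' : k v = k w := hvw
    rw [← extend_comp_eq e (g w) (hbase v w), ← hk v, hvw', hk w,
      extend_comp_eq e (g w) fun i _ => rfl]

/-- There are at least as many copies of `T` as parallel subcubes. -/
theorem two_pow_le_copyCount_parallelCopies [Nonempty W] :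
    2 ^ (n - s) ≤ (parallelCopies e f).copyCount T := by
  classical
  let β := {i : Fin n // ¬∃ t, e t = i} → Bool
  have hβ : Nat.card β = 2 ^ (n - s) := by
    have h1 : Fintype.card {i : Fin n // ∃ t, e t = i} = s := by
      rw [← Nat.card_eq_fintype_card]
      exact (Nat.card_congr (Equiv.ofInjective e e.injective)).symm.trans (Nat.card_fin s)
    rw [Nat.card_eq_fintype_card, Fintype.card_fun, Fintype.card_bool, Fintype.card_subtype_compl,
      Fintype.card_fin, h1]
  let b : β → Fin n → Bool := fun v i => if h : ¬∃ t, e t = i then v ⟨i, h⟩ else false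
  let F : β → SimpleGraph.Copy T (parallelCopies e f) := fun v =>
    { toHom :=
        { toFun := fun p => Function.extend e (f p) (b v)
          map_rel' := by
            intro p p' hp
            refine ⟨fun i hi => ?_, p, p', hp, ?_, ?_⟩
            · rw [Function.extend_apply' _ _ _ hi, Function.extend_apply' _ _ _ hi]
            · exact (extend_comp_embedding e _ _).symm
            · exact (extend_comp_embedding e _ _).symm }
      injective' := fun p p' h => f.injective (extend_embedding_injective e (b v) h) }
  rw [← hβ, copyCount_eq_natCard]
  refine Nat.card_le_card_of_injective (fun v => ⟨(F v).toSubgraph, ⟨(F v).isoToSubgraph⟩⟩) ?_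
  intro v v' h
  have h1 : (F v).toSubgraph.verts = (F v').toSubgraph.verts :=
    congrArg SimpleGraph.Subgraph.verts (congrArg Subtype.val h)
  obtain ⟨p⟩ := ‹Nonempty W›
  -- Any vertex of a copy reveals the values at the fixed positions, so different subcubes give
  -- different subgraphs.
  have h2 : F v p ∈ (F v).toSubgraph.verts := ⟨p, trivial, rfl⟩
  rw [h1] at h2
  obtain ⟨p', -, hp'⟩ := h2
  funext ⟨i, hi⟩
  have h3 : Function.extend e (f p') (b v') i = Function.extend e (f p) (b v) i :=
    congrFun hp' i
  rw [Function.extend_apply' _ _ _ hi, Function.extend_apply' _ _ _ hi] at h3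
  simp only [b, dif_pos hi] at h3
  exact h3.symm

end ParallelCopies

theorem exists_cycleGraph_adj {N : ℕ} (hN : 2 ≤ N) (v : Fin N) :
    ∃ w, (SimpleGraph.cycleGraph N).Adj v w := by
  obtain ⟨N, rfl⟩ := Nat.exists_eq_add_of_le' hN
  exact ⟨v + 1, SimpleGraph.cycleGraph_adj.2 (Or.inr (by simp))⟩

/-- The lower bound for the generalized extremal number by vertex disjoint cycles. -/
theorem two_pow_le_genEx {k l q n : ℕ} (hk : 2 ≤ k) (hl : 2 ≤ l) (hlk : l ≠ k)
    (hq : 2 * l ≤ 2 ^ q) (hqn : q ≤ n) :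
    2 ^ (n - q) ≤ genEx (hypercube n) (SimpleGraph.cycleGraph (2 * l))
      (SimpleGraph.cycleGraph (2 * k)) := by
  obtain ⟨f⟩ := cycleGraph_isContained_hypercube hl hq
  have : Nonempty (Fin (2 * l)) := ⟨⟨0, by omega⟩⟩
  refine (two_pow_le_copyCount_parallelCopies (Fin.castLEEmb hqn) f).trans ?_
  refine le_csSup (genEx_set_finite _ _ _).bddAbove ⟨_, parallelCopies_le _ f, fun h => ?_, rfl⟩
  have h1 := isContained_of_isContained_parallelCopies _ f SimpleGraph.cycleGraph_preconnected
    (exists_cycleGraph_adj (by omega)) h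
  have := eq_of_cycleGraph_isContained (by omega) (by omega) h1
  omega

/-! ### Star positions and the asymptotic number of cycles -/

section StarPositions

variable {n N : ℕ}

open Classical in
/-- The positions in which not all vertices of a copy agree. -/
noncomputable def varyingPositions {W : Type*} {T : SimpleGraph W}
    (f : SimpleGraph.Copy T (hypercube n)) : Finset (Fin n) :=
  Finset.univ.filter fun i => ∃ p p', f p i ≠ f p' i

/-- Every varying position of a cycle is the star position of an edge. -/
theorem exists_star_of_mem_varyingPositions
    (f : SimpleGraph.Copy (SimpleGraph.cycleGraph (N + 3)) (hypercube n)) {i : Fin n}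
    (hi : i ∈ varyingPositions f) : ∃ p, f p i ≠ f (p + 1) i := by
  by_contra! hcon
  simp only [varyingPositions, Finset.mem_filter, Finset.mem_univ, true_and] at hi
  obtain ⟨p, p', hpp'⟩ := hi
  apply hpp'
  obtain ⟨w⟩ := SimpleGraph.cycleGraph_preconnected p p'
  clear hpp'
  induction w with
  | nil => rfl
  | cons h _ ih =>
    refine Eq.trans ?_ ih
    rcases SimpleGraph.cycleGraph_adj.1 h with h | h
    · rw [eq_add_of_sub_eq' h]
      exact (hcon _).symm
    · rw [eq_add_of_sub_eq' h]
      exact hcon _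

/-- A star position of a cycle occurs at least twice. -/
theorem exists_ne_star (f : Fin (N + 3) → Fin n → Bool) {i : Fin n} {p : Fin (N + 3)}
    (hp : f p i ≠ f (p + 1) i) : ∃ p', p' ≠ p ∧ f p' i ≠ f (p' + 1) i := by
  by_contra! hcon
  -- The differences of the coordinate around the cycle telescope to zero, so there cannot be
  -- exactly one nonzero difference.
  let c : Fin (N + 3) → ℤ := fun p => if f p i then 1 else 0
  have h1 : ∑ p, (c p - c (p + 1)) = 0 := by
    rw [Finset.sum_sub_distrib, sub_eq_zero]
    exact (Equiv.sum_comp (Equiv.addRight (1 : Fin (N + 3))) c).symm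
  rw [Finset.sum_eq_single p (fun q _ hq => by simp only [c]; rw [hcon q hq, sub_self])
    (by simp)] at h1
  apply hp
  simp only [c] at h1
  cases h2 : f p i <;> cases h3 : f (p + 1) i <;> simp_all

/-- A cycle of length `N + 3` in a hypercube has at most `(N + 3) / 2` star positions. -/
theorem two_mul_card_varyingPositions_le
    (f : SimpleGraph.Copy (SimpleGraph.cycleGraph (N + 3)) (hypercube n)) :
    2 * (varyingPositions f).card ≤ N + 3 := by
  classical
  -- Double counting of pairs (position, edge): every varying position is flipped at least twice,
  -- every edge flips one position.
  have h := Finset.sum_card_bipartiteAbove_eq_sum_card_bipartiteBelow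
    (s := varyingPositions f) (t := (Finset.univ : Finset (Fin (N + 3))))
    (fun i p => f p i ≠ f (p + 1) i)
  have h1 : ∀ i ∈ varyingPositions f, 2 ≤ ((Finset.univ : Finset (Fin (N + 3))).bipartiteAbove
      (fun i p => f p i ≠ f (p + 1) i) i).card := by
    intro i hi
    obtain ⟨p, hp⟩ := exists_star_of_mem_varyingPositions f hi
    obtain ⟨p', hpp', hp'⟩ := exists_ne_star (fun p => f p) hp
    exact Finset.one_lt_card.2 ⟨p, by simpa [Finset.mem_bipartiteAbove] using hp, p',
      by simpa [Finset.mem_bipartiteAbove] using hp', hpp'.symm⟩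
  have h2 : ∀ p ∈ (Finset.univ : Finset (Fin (N + 3))), ((varyingPositions f).bipartiteBelow
      (fun i p => f p i ≠ f (p + 1) i) p).card ≤ 1 := by
    intro p _
    have hadj : (hypercube n).Adj (f p) (f (p + 1)) :=
      f.toHom.map_adj (SimpleGraph.cycleGraph_adj.2 (Or.inr (by simp)))
    obtain ⟨t, ht⟩ := hypercube_adj_iff.1 hadj
    have key : ∀ i ∈ (varyingPositions f).bipartiteBelow (fun i p => f p i ≠ f (p + 1) i) p,
        i = t := by
      intro i hi
      rw [Finset.mem_bipartiteBelow, ht] at hi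
      by_contra hne
      exact hi.2 (by simp [flipOn, hne])
    exact Finset.card_le_one.2 fun i hi j hj => (key i hi).trans (key j hj).symm
  have h3 := Finset.card_nsmul_le_sum _ _ _ h1
  have h4 := Finset.sum_le_card_nsmul _ _ _ h2
  rw [h] at h3
  simp only [smul_eq_mul, Finset.card_univ, Fintype.card_fin] at h3 h4
  omega

end StarPositions

/-- A copy that varies only in the positions in the range of `e` comes from a subcube. -/
theorem exists_copy_subcube {s n : ℕ} {W : Type*} [Nonempty W] {T : SimpleGraph W}
    (f : SimpleGraph.Copy T (hypercube n)) (e : Fin s ↪ Fin n)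
    (he : ∀ i ∈ varyingPositions f, ∃ t, e t = i) :
    ∃ (g : SimpleGraph.Copy T (hypercube s)) (b : Fin n → Bool),
      (∀ p, f p = Function.extend e (g p) b) ∧ ∀ p, g p = f p ∘ e := by
  obtain ⟨p₀⟩ := ‹Nonempty W›
  have hf : ∀ p, Function.extend e (f p ∘ e) (f p₀) = f p := by
    intro p
    refine extend_comp_eq e _ fun i hi => ?_
    by_contra hne
    exact hi (he i (by simpa [varyingPositions] using ⟨p, p₀, hne⟩))
  refine ⟨⟨⟨fun p => f p ∘ e, ?_⟩, ?_⟩, f p₀, fun p => (hf p).symm, fun p => rfl⟩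
  · intro p p' hp
    rw [← hypercube_adj_extend_iff e (f p₀), hf, hf]
    exact f.toHom.map_adj hp
  · intro p p' h
    apply f.injective
    change f p = f p'
    have h' : f p ∘ e = f p' ∘ e := h
    rw [← hf p, h', hf p']

/-- The family of subgraphs obtained by placing the members of `Z` into all subcubes of
dimension `s`. -/
theorem ncard_le_of_subcubes {s n : ℕ} (Z : Set (hypercube s).Subgraph)
    (𝒞 : Set (hypercube n).Subgraph)
    (h : ∀ C ∈ 𝒞, ∃ (J : Finset (Fin n)) (hJ : J.card = s) (b : Fin n → Bool), ∃ C' ∈ Z,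
      C = C'.map (subcubeHom (J.orderEmbOfFin hJ).toEmbedding b)) :
    𝒞.ncard ≤ n.choose s * 2 ^ (n - s) * Z.ncard := by
  classical
  -- A subcube is coded by its free positions `J` and its base values outside `J`, recorded as a
  -- subset of the complement. Base values on `J` have no effect.
  let Ω : Finset (Σ _ : Finset (Fin n), Finset (Fin n) × (hypercube s).Subgraph) :=
    (Finset.univ.powersetCard s).sigma fun J => (Finset.univ \ J).powerset ×ˢ Z.toFinite.toFinset
  have hΩ : Ω.card = n.choose s * 2 ^ (n - s) * Z.ncard := by
    rw [Finset.card_sigma, Finset.sum_congr rfl (g := fun _ => 2 ^ (n - s) * Z.ncard),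
      Finset.sum_const, Finset.card_powersetCard, Finset.card_univ, Fintype.card_fin, smul_eq_mul,
      mul_assoc]
    intro J hJ
    rw [Finset.mem_powersetCard] at hJ
    rw [Finset.card_product, Finset.card_powerset, Finset.card_sdiff_of_subset hJ.1, hJ.2,
      Finset.card_univ, Fintype.card_fin, Set.ncard_eq_toFinset_card _ Z.toFinite]
  rw [← hΩ, Set.ncard_eq_toFinset_card _ 𝒞.toFinite]
  let F : (Σ _ : Finset (Fin n), Finset (Fin n) × (hypercube s).Subgraph) →
      (hypercube n).Subgraph := fun ω =>
    if hJ : ω.1.card = s then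
      ω.2.2.map (subcubeHom (ω.1.orderEmbOfFin hJ).toEmbedding fun i => decide (i ∈ ω.2.1))
    else ⊥
  refine Finset.card_le_card_of_surjOn F ?_
  intro C hC
  obtain ⟨J, hJ, b, C', hC', rfl⟩ := h C (by simpa using hC)
  refine ⟨⟨J, (Finset.univ \ J).filter fun i => b i, C'⟩, ?_, ?_⟩
  · rw [Finset.mem_coe, Finset.mem_sigma, Finset.mem_powersetCard, Finset.mem_product,
      Finset.mem_powerset, Set.Finite.mem_toFinset]
    exact ⟨⟨Finset.subset_univ _, hJ⟩, Finset.filter_subset _ _, hC'⟩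
  · simp only [F, dif_pos hJ]
    congr 1
    refine RelHom.ext fun z => ?_
    rw [subcubeHom_apply, subcubeHom_apply]
    funext i
    by_cases hi : ∃ t, (J.orderEmbOfFin hJ).toEmbedding t = i
    · obtain ⟨t, rfl⟩ := hi
      rw [Function.Injective.extend_apply (Function.Embedding.injective _),
        Function.Injective.extend_apply (Function.Embedding.injective _)]
    · have hiJ : i ∉ J := by
        intro h
        have : i ∈ Set.range (J.orderEmbOfFin hJ) := by
          rw [Finset.range_orderEmbOfFin]
          exact h
        exact hi this
      rw [Function.extend_apply' _ _ _ hi, Function.extend_apply' _ _ _ hi]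
      simp [hiJ]

/-- Almost all cycles of length `2 l` have `l` star positions. -/
theorem copyCount_cycleGraph_le {l n : ℕ} (hl : 2 ≤ l) (hln : l ≤ n) :
    (hypercube n).copyCount (SimpleGraph.cycleGraph (2 * l)) ≤
      n.choose l * 2 ^ (n - l) * starCycleCount l l +
      n.choose (l - 1) * 2 ^ (n - (l - 1)) *
        (hypercube (l - 1)).copyCount (SimpleGraph.cycleGraph (2 * l)) := by
  obtain ⟨N, hN⟩ : ∃ N, 2 * l = N + 3 := ⟨2 * l - 3, by omega⟩
  have : Nonempty (Fin (2 * l)) := ⟨⟨0, by omega⟩⟩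
  let 𝒞 : Set (hypercube n).Subgraph := {C | Nonempty (SimpleGraph.cycleGraph (2 * l) ≃g C.coe)}
  let 𝒞₁ : Set (hypercube n).Subgraph := {C | ∃ f : SimpleGraph.Copy
    (SimpleGraph.cycleGraph (2 * l)) (hypercube n), f.toSubgraph = C ∧
      (varyingPositions f).card = l}
  let 𝒞₂ : Set (hypercube n).Subgraph := {C | ∃ f : SimpleGraph.Copy
    (SimpleGraph.cycleGraph (2 * l)) (hypercube n), f.toSubgraph = C ∧
      (varyingPositions f).card ≤ l - 1}
  have hcov : 𝒞 ⊆ 𝒞₁ ∪ 𝒞₂ := by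
    intro C hC
    obtain ⟨f, -, hf⟩ := SimpleGraph.Copy.toSubgraph_surjOn hC
    have h1 : 2 * (varyingPositions f).card ≤ 2 * l := by
      clear hf
      revert f
      rw [hN]
      exact fun f => two_mul_card_varyingPositions_le f
    rcases (show (varyingPositions f).card = l ∨ (varyingPositions f).card ≤ l - 1 by omega)
      with h | h
    · exact Or.inl ⟨f, hf, h⟩
    · exact Or.inr ⟨f, hf, h⟩
  have hmap : ∀ {s : ℕ} (f : SimpleGraph.Copy (SimpleGraph.cycleGraph (2 * l)) (hypercube n))
      (g : SimpleGraph.Copy (SimpleGraph.cycleGraph (2 * l)) (hypercube s)) (e : Fin s ↪ Fin n)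
      (b : Fin n → Bool), (∀ p, f p = Function.extend e (g p) b) →
      f.toSubgraph = g.toSubgraph.map (subcubeHom e b) := by
    intro s f g e b h
    have hcomp : f.toHom = (subcubeHom e b).comp g.toHom := RelHom.ext h
    rw [SimpleGraph.Copy.toSubgraph, SimpleGraph.Copy.toSubgraph, hcomp,
      SimpleGraph.Subgraph.map_comp]
  have hrange : ∀ {s : ℕ} (J : Finset (Fin n)) (hJ : J.card = s), ∀ i ∈ J, ∃ t,
      (J.orderEmbOfFin hJ).toEmbedding t = i := by
    intro s J hJ i hi
    have : i ∈ Set.range (J.orderEmbOfFin hJ) := by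
      rw [Finset.range_orderEmbOfFin]
      exact hi
    exact this
  have h1 : 𝒞₁.ncard ≤ n.choose l * 2 ^ (n - l) * starCycleCount l l := by
    refine ncard_le_of_subcubes _ _ ?_
    rintro C ⟨f, rfl, hf⟩
    obtain ⟨g, b, hfg, hgf⟩ := exists_copy_subcube f
      ((varyingPositions f).orderEmbOfFin hf).toEmbedding (hrange _ hf)
    refine ⟨_, hf, b, g.toSubgraph, ⟨⟨g.isoToSubgraph⟩, fun t => ?_⟩, hmap f g _ b hfg⟩
    obtain ⟨p, p', hpp', hne⟩ : ∃ p p', (SimpleGraph.cycleGraph (2 * l)).Adj p p' ∧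
        f p ((varyingPositions f).orderEmbOfFin hf t) ≠
          f p' ((varyingPositions f).orderEmbOfFin hf t) := by
      have hmem := (varyingPositions f).orderEmbOfFin_mem hf t
      generalize (varyingPositions f).orderEmbOfFin hf t = i at hmem
      clear hfg hgf hf g b t
      revert f
      rw [hN]
      intro f hmem
      obtain ⟨p, hp⟩ := exists_star_of_mem_varyingPositions f hmem
      exact ⟨p, p + 1, SimpleGraph.cycleGraph_adj.2 (Or.inr (by simp)), hp⟩
    refine ⟨g p, g p', ?_, ?_⟩
    · rw [SimpleGraph.Subgraph.map_adj]
      exact ⟨p, p', hpp', rfl, rfl⟩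
    · rw [hgf, hgf]
      exact hne
  have h2 : 𝒞₂.ncard ≤ n.choose (l - 1) * 2 ^ (n - (l - 1)) *
      (hypercube (l - 1)).copyCount (SimpleGraph.cycleGraph (2 * l)) := by
    rw [copyCount_eq_natCard]
    refine ncard_le_of_subcubes
      {C | Nonempty (SimpleGraph.cycleGraph (2 * l) ≃g C.coe)} _ ?_
    rintro C ⟨f, rfl, hf⟩
    -- The varying positions are padded to exactly `l - 1`. A cycle may then lie in several of the
    -- subcubes, which is harmless for an upper bound.
    obtain ⟨J, hJf, hJ⟩ := Finset.exists_superset_card_eq hf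
      (show l - 1 ≤ Fintype.card (Fin n) by rw [Fintype.card_fin]; omega)
    obtain ⟨g, b, hfg, -⟩ := exists_copy_subcube f (J.orderEmbOfFin hJ).toEmbedding
      fun i hi => hrange J hJ i (hJf hi)
    exact ⟨J, hJ, b, g.toSubgraph, ⟨g.isoToSubgraph⟩, hmap f g _ b hfg⟩
  calc (hypercube n).copyCount (SimpleGraph.cycleGraph (2 * l)) = 𝒞.ncard := by
        rw [copyCount_eq_natCard]
        rfl
    _ ≤ (𝒞₁ ∪ 𝒞₂).ncard := Set.ncard_le_ncard hcov (Set.toFinite _)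
    _ ≤ 𝒞₁.ncard + 𝒞₂.ncard := Set.ncard_union_le _ _
    _ ≤ _ := Nat.add_le_add h1 h2

/-- `2 l ≤ 2 ^ l` for `l ≥ 2`. -/
theorem two_mul_le_two_pow {l : ℕ} (hl : 2 ≤ l) : 2 * l ≤ 2 ^ l := by
  induction l, hl using Nat.le_induction with
  | base => norm_num
  | succ l hl ih =>
    rw [pow_succ]
    omega

/-- The cycles of length `2 l` with `l` star positions dominate asymptotically. -/
theorem tendsto_one_sub_div_copyCount {l : ℕ} (hl : 2 ≤ l) :
    Filter.Tendsto (fun n : ℕ => max 0 (1 - ((n.choose l : ℝ) * 2 ^ (n - l) * starCycleCount l l) /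
      (hypercube n).copyCount (SimpleGraph.cycleGraph (2 * l)))) Filter.atTop (nhds 0) := by
  set z : ℝ := (starCycleCount l l : ℝ) with hz
  set K : ℝ := ((hypercube (l - 1)).copyCount (SimpleGraph.cycleGraph (2 * l)) : ℝ) with hK
  have hzpos : 0 < z := Nat.cast_pos.2 (starCycleCount_pos hl)
  have hK0 : 0 ≤ K := Nat.cast_nonneg _
  -- This is the ratio of the error term to the main term: `l / (n - l + 1)` comes from the two
  -- binomials, the factor 2 from the powers of two, and `K / z` from the counts in the small cubes.
  have hlim : Filter.Tendsto (fun n : ℕ => 2 * K * l / z / ((n - l + 1 : ℕ) : ℝ)) Filter.atTop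
      (nhds 0) := by
    refine Filter.Tendsto.div_atTop tendsto_const_nhds ?_
    refine tendsto_natCast_atTop_atTop.comp ?_
    exact Filter.tendsto_atTop_mono (fun n => by omega) (Filter.tendsto_sub_atTop_nat l)
  -- The `max` supplies nonnegativity without a proof that the main term is at most the number of
  -- all cycles.
  refine squeeze_zero' (Filter.Eventually.of_forall fun n => le_max_left _ _) ?_ hlim
  filter_upwards [Filter.eventually_ge_atTop l] with n hn
  refine max_le (by positivity) ?_
  have hN : 0 < ((hypercube n).copyCount (SimpleGraph.cycleGraph (2 * l)) : ℝ) := by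
    have := SimpleGraph.copyCount_pos.2 (cycleGraph_isContained_hypercube hl
      ((two_mul_le_two_pow hl).trans (Nat.pow_le_pow_right (by norm_num) hn)))
    exact_mod_cast this
  have hle : ((hypercube n).copyCount (SimpleGraph.cycleGraph (2 * l)) : ℝ) ≤
      (n.choose l : ℝ) * 2 ^ (n - l) * z + (n.choose (l - 1) : ℝ) * 2 ^ (n - (l - 1)) * K := by
    rw [hz, hK]
    exact_mod_cast copyCount_cycleGraph_le hl hn
  set X : ℝ := ((hypercube n).copyCount (SimpleGraph.cycleGraph (2 * l)) : ℝ)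
  have hch : (n.choose l : ℝ) * l = n.choose (l - 1) * ((n - l + 1 : ℕ) : ℝ) := by
    have := Nat.choose_succ_right_eq n (l - 1)
    rw [show l - 1 + 1 = l by omega, show n - (l - 1) = n - l + 1 by omega] at this
    exact_mod_cast this
  have hD : (0 : ℝ) < ((n - l + 1 : ℕ) : ℝ) := by positivity
  set D : ℝ := ((n - l + 1 : ℕ) : ℝ)
  set A : ℝ := (n.choose l : ℝ) * 2 ^ (n - l) * z with hA
  have hApos : 0 < A := by
    have : 0 < n.choose l := Nat.choose_pos hn
    positivity
  have hB : (n.choose (l - 1) : ℝ) * 2 ^ (n - (l - 1)) * K = A * (2 * K * l / z / D) := by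
    rw [show n - (l - 1) = n - l + 1 by omega, pow_succ, hA]
    field_simp
    linear_combination (-K) * hch
  rw [hB] at hle
  set δ : ℝ := 2 * K * l / z / D
  have hδ : 0 ≤ δ := by positivity
  rw [sub_le_comm, le_div_iff₀ hN]
  -- For `δ ≤ 1` the claim follows from `(1 - δ) * (1 + δ) ≤ 1`; for larger `δ` its left side is
  -- negative.
  rcases le_or_gt δ 1 with h | h
  · calc (1 - δ) * X ≤ (1 - δ) * (A + A * δ) := by
          exact mul_le_mul_of_nonneg_left hle (by linarith)
      _ = A * (1 - δ ^ 2) := by ring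
      _ ≤ A := by nlinarith [mul_nonneg hApos.le (sq_nonneg δ)]
  · nlinarith

/-! ### The two bounds together -/

theorem theorem7 (k : ℕ) (hk : 4 ≤ k) (hk5 : k ≠ 5) :
    ∃ c : ℝ, 0 < c ∧ ∀ l : ℕ, 2 ≤ l → l ≠ k →
      0 < starCycleCount l l ∧
      ∃ ε : ℕ → ℝ, (∀ n, 0 ≤ ε n) ∧ Filter.Tendsto ε Filter.atTop (nhds 0) ∧
        ∀ n : ℕ, 2 * l ≤ 2 ^ n →
          0 < (hypercube n).copyCount (SimpleGraph.cycleGraph (2 * l)) ∧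
          (l ≤ n →
            ((n.choose l : ℕ) : ℝ)⁻¹ *
                ((2 : ℝ) ^ ((l : ℤ) - ⌈Real.logb 2 (2 * (l : ℝ))⌉) / (starCycleCount l l : ℝ)) *
                (1 - ε n) ≤
              genTuranDensity (hypercube n) (SimpleGraph.cycleGraph (2 * l))
                (SimpleGraph.cycleGraph (2 * k))) ∧
          genTuranDensity (hypercube n) (SimpleGraph.cycleGraph (2 * l))
              (SimpleGraph.cycleGraph (2 * k)) ≤
            c * (n : ℝ) ^ (-(1 / 16) : ℝ) := by
  obtain ⟨c, hc, hupper⟩ := exists_genTuranDensity_le k hk hk5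
  refine ⟨c, hc, fun l hl hlk => ⟨starCycleCount_pos hl, _, fun n => le_max_left _ _,
    tendsto_one_sub_div_copyCount hl, fun n hn => ?_⟩⟩
  have hNpos := SimpleGraph.copyCount_pos.2 (cycleGraph_isContained_hypercube hl hn)
  refine ⟨hNpos, fun hln => ?_, ?_⟩
  · have hq : ⌈Real.logb 2 (2 * (l : ℝ))⌉ = (Nat.clog 2 (2 * l) : ℤ) := by
      have h1 := Real.ceil_logb_natCast (b := 2) (r := 2 * (l : ℝ)) (by positivity)
      rw [Nat.cast_ofNat] at h1
      rw [h1]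
      have h2 := Int.clog_natCast (R := ℝ) 2 (2 * l)
      push_cast at h2
      exact h2
    have hqn : Nat.clog 2 (2 * l) ≤ n := (Nat.clog_le_iff_le_pow (by norm_num)).2 hn
    have hex := two_pow_le_genEx (k := k) (by omega) hl hlk
      (Nat.le_pow_clog (by norm_num) (2 * l)) hqn
    rw [hq, genTuranDensity]
    set q := Nat.clog 2 (2 * l)
    have hex' : (2 : ℝ) ^ (n - q) ≤ genEx (hypercube n) (SimpleGraph.cycleGraph (2 * l))
      (SimpleGraph.cycleGraph (2 * k)) := by exact_mod_cast hex
    have hX : 0 < ((hypercube n).copyCount (SimpleGraph.cycleGraph (2 * l)) : ℝ) := by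
      exact_mod_cast hNpos
    have hz : 0 < (starCycleCount l l : ℝ) := by exact_mod_cast starCycleCount_pos hl
    have hch : 0 < ((n.choose l : ℕ) : ℝ) := by exact_mod_cast Nat.choose_pos hln
    set X := ((hypercube n).copyCount (SimpleGraph.cycleGraph (2 * l)) : ℝ)
    set z := (starCycleCount l l : ℝ)
    set b := ((n.choose l : ℕ) : ℝ)
    have hpow : (2 : ℝ) ^ ((l : ℤ) - (q : ℤ)) * 2 ^ (n - l) = 2 ^ (n - q) := by
      rw [← zpow_natCast, ← zpow_natCast, ← zpow_add₀ (by norm_num), Nat.cast_sub hln,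
        Nat.cast_sub hqn]
      congr 1
      ring
    -- With `r` the quotient, `1 - max 0 (1 - r)` is `min 1 r`. Multiplying by `r` cancels the
    -- binomial coefficient and `z`.
    have hε : 1 - max 0 (1 - b * 2 ^ (n - l) * z / X) ≤ b * 2 ^ (n - l) * z / X := by
      have := le_max_right 0 (1 - b * 2 ^ (n - l) * z / X)
      linarith
    calc b⁻¹ * (2 ^ ((l : ℤ) - (q : ℤ)) / z) * (1 - max 0 (1 - b * 2 ^ (n - l) * z / X))
        ≤ b⁻¹ * (2 ^ ((l : ℤ) - (q : ℤ)) / z) * (b * 2 ^ (n - l) * z / X) := by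
          exact mul_le_mul_of_nonneg_left hε (by positivity)
      _ = (2 ^ ((l : ℤ) - (q : ℤ)) * 2 ^ (n - l)) / X := by field_simp
      _ = 2 ^ (n - q) / X := by rw [hpow]
      _ ≤ _ := by gcongr
  · have hn0 : 0 < n := by
      rcases Nat.eq_zero_or_pos n with rfl | h
      · rw [pow_zero] at hn
        omega
      · exact h
    obtain ⟨w, hw⟩ := exists_cycleGraph_adj (N := 2 * l) (by omega) ⟨0, by omega⟩
    exact hupper n hn0 _ _ _ hw
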